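/- For non-negative integers $n_1,\dots,n_d$ let $\mathcal G=\mathbb F_2^{n_1}\otimes\dots\otimes\mathbb F_2^{n_d}$ and let $\mathcal B$ be the multiset $\{u_1\otimes\dots\otimes u_d: u_i\in\mathbb F_2^{n_i}\text{ for all }i\}$, in which every tuple $(u_1,\dots,u_d)$ contributes one element (so $|\mathcal B|=2^{n_1+\dots+n_d}$). For a multiset $B$ of elements of $\mathcal G$ and $\eta\in\mathbb R$, a set $\mathcal A\subset\mathcal G$ is called $(B,\eta)$-closed if the number of pairs $(a,b)\in\mathcal A\times B$ with $a+b\in\mathcal A$, where $b$ is counted with multiplicity, is at least $\eta|\mathcal A||B|$. For $I\subset[d]$ write $\mathbb F_2^I=\bigotimes_{i\in I}\mathbb F_2^{n_i}$ and $I^c=[d]\setminus I$, so that $\mathcal G=\mathbb F_2^I\otimes\mathbb F_2^{I^c}$. A set $\mathcal D\subset\mathcal G$ is called $k$-simple if there are subspaces $H_I\subset\mathbb F_2^I$ of codimension at most $k$, one for each non-empty $I\subset[d]$, such that $\mathcal D$ is a translate of $\bigcap_{I\subset[d],\,I\ne\emptyset}(H_I\otimes\mathbb F_2^{I^c})$.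 **Corollary.** For every positive integer $d$ there exists $\epsilon=\epsilon(d)>0$ such that for every $\delta>0$ there exists a positive integer $k=k(d,\delta)$ with the following property. For all non-negative integers $n_1,\dots,n_d$, every sub-multiset $\mathcal B'\subset\mathcal B$ with $|\mathcal B'|\ge\delta|\mathcal B|$ and every non-empty $\mathcal A\subset\mathcal G$ that is $(\mathcal B',1-\epsilon)$-closed, there exists a $k$-simple set $\mathcal D\subset\mathcal G$ with $|\mathcal D\cap\mathcal A|\ge\frac12|\mathcal D|$. -/

import Mathlib

open scoped TensorProduct

noncomputable section

namespace RankOneClosed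

/-- The vector space `𝔽₂^m`. -/
abbrev F2 (m : ℕ) : Type := Fin m → ZMod 2

/-- The space `𝔽₂^{n₁} ⊗ ⋯ ⊗ 𝔽₂^{n_d}`. -/
abbrev Tens {d : ℕ} (n : Fin d → ℕ) : Type :=
  ⨂[ZMod 2] i : Fin d, F2 (n i)

/-- The space `𝔽₂^I`, the tensor product of the `𝔽₂^{n_i}` with `i ∈ I`. -/
abbrev TensOn {d : ℕ} (n : Fin d → ℕ) (I : Finset (Fin d)) : Type :=
  ⨂[ZMod 2] i : {i : Fin d // i ∈ I}, F2 (n i)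

/-- The space `𝔽₂^{Iᶜ}`, the tensor product of the `𝔽₂^{n_i}` with `i ∉ I`. -/
abbrev TensOff {d : ℕ} (n : Fin d → ℕ) (I : Finset (Fin d)) : Type :=
  ⨂[ZMod 2] i : {i : Fin d // i ∉ I}, F2 (n i)

/-- The natural identification `𝔽₂^I ⊗ 𝔽₂^{Iᶜ} = 𝔽₂^{n₁} ⊗ ⋯ ⊗ 𝔽₂^{n_d}`. -/
def glue {d : ℕ} (n : Fin d → ℕ) (I : Finset (Fin d)) :
    (TensOn n I ⊗[ZMod 2] TensOff n I) ≃ₗ[ZMod 2] Tens n :=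
  (PiTensorProduct.tmulEquivDep (ZMod 2)
    (fun x : {i : Fin d // i ∈ I} ⊕ {i : Fin d // i ∉ I} =>
      F2 (n (Equiv.sumCompl (fun i => i ∈ I) x)))).trans
  (PiTensorProduct.reindex (ZMod 2) (fun i => F2 (n i))
    (Equiv.sumCompl (fun i => i ∈ I)).symm).symm

/-- The identification `glue` is the expected one on pure tensors. -/
theorem glue_tprod {d : ℕ} (n : Fin d → ℕ) (I : Finset (Fin d)) (u : (i : Fin d) → F2 (n i)) :
    glue n I ((PiTensorProduct.tprod (ZMod 2) fun i : {i : Fin d // i ∈ I} => u i) ⊗ₜ[ZMod 2]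
      (PiTensorProduct.tprod (ZMod 2) fun i : {i : Fin d // i ∉ I} => u i)) =
    PiTensorProduct.tprod (ZMod 2) u := by
  let e := Equiv.sumCompl (fun i => i ∈ I)
  have h := PiTensorProduct.tmulEquivDep_apply (ZMod 2)
    (fun x : {i : Fin d // i ∈ I} ⊕ {i : Fin d // i ∉ I} => F2 (n (e x)))
    (fun i => u i) (fun i => u i)
  refine (congrArg (PiTensorProduct.reindex (ZMod 2) (fun i => F2 (n i)) e.symm).symm h).trans ?_
  refine (LinearEquiv.symm_apply_eq _).2 ?_
  refine Eq.trans ?_ (PiTensorProduct.reindex_tprod (R := ZMod 2) e.symm u).symm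
  refine congrArg (PiTensorProduct.tprod (ZMod 2)) (funext fun x => ?_)
  cases x <;> rfl

/-- The subspace `H ⊗ 𝔽₂^{Iᶜ}` of `𝔽₂^{n₁} ⊗ ⋯ ⊗ 𝔽₂^{n_d}`, for a subspace `H` of `𝔽₂^I`. -/
def cylinder {d : ℕ} (n : Fin d → ℕ) (I : Finset (Fin d))
    (H : Submodule (ZMod 2) (TensOn n I)) : Submodule (ZMod 2) (Tens n) :=
  (LinearMap.range (H.subtype.rTensor (TensOff n I))).map (glue n I).toLinearMap

/-- A set is `k`-simple if it is a translate of `⋂_{I ≠ ∅} (H_I ⊗ 𝔽₂^{Iᶜ})` for subspaces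
`H_I ⊆ 𝔽₂^I` of codimension at most `k`. -/
def IsSimple {d : ℕ} (n : Fin d → ℕ) (k : ℕ) (C : Set (Tens n)) : Prop :=
  ∃ (H : (I : Finset (Fin d)) → Submodule (ZMod 2) (TensOn n I)) (x : Tens n),
    (∀ I : Finset (Fin d), I.Nonempty → Module.finrank (ZMod 2) (TensOn n I ⧸ H I) ≤ k) ∧
    C = (fun y => x + y) ''
      {y : Tens n | ∀ I : Finset (Fin d), I.Nonempty → y ∈ cylinder n I (H I)}

/-- The multiset of all `u₁ ⊗ ⋯ ⊗ u_d` with `u_i ∈ 𝔽₂^{n_i}`: each tuple `(u₁, …, u_d)`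
contributes one element, also when some `u_i` is zero. -/
def rankOne {d : ℕ} (n : Fin d → ℕ) : Multiset (Tens n) :=
  (Finset.univ : Finset ((i : Fin d) → F2 (n i))).val.map
    (fun u => PiTensorProduct.tprod (ZMod 2) u)

/-- `A` is `(B, η)`-closed: the number of pairs `(a, b) ∈ A × B` with `a + b ∈ A`, where `b`
is counted with its multiplicity in `B`, is at least `η |A| |B|`. -/
def IsClosedFor {G : Type} [AddCommGroup G] [Finite G] (B : Multiset G) (η : ℝ) (A : Set G) :
    Prop :=
  η * (A.ncard : ℝ) * (Multiset.card B : ℝ) ≤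
    (((B.map fun b => {a : G | a ∈ A ∧ a + b ∈ A}.ncard).sum : ℕ) : ℝ)

instance finite_tens {d : ℕ} (n : Fin d → ℕ) : Finite (Tens n) :=
  Module.finite_of_finite (ZMod 2)

end RankOneClosed

end

/-!
The Fourier transform of the indicator function of `A` turns the claim into one about multilinear
forms. If `A` is almost closed under `B'`, then half of the elements `b` of `B'` satisfy
`|A ∩ (A + b)| ≥ (1 - 2 ε) |A|`, and for each of these all but `ε` of the Fourier mass of `A` is on
linear functionals that vanish at `b`. A functional on the tensor product is a multilinear form `r`
on `∏ 𝔽₂^{n_i}`. So there is a random form `r`, and a dense set `B` of points, such that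
`P(r(b) ≠ 0) ≤ ε` for each `b ∈ B`. The theorem `captures` says that then `r` lies with
probability at least `1 / 2` in a space `∑_I ∑_σ σ ⊗ (forms in Iᶜ)`, with boundedly many
forms `σ` in the coordinates `I ≠ ∅`. This space annihilates the intersection `W` of the cylinders
over the common kernels of the `σ`, so half of the Fourier mass of `A` is on the annihilator of
`W`, and `A` has density at least `1 / 2` in some coset of `W`.

The theorem `captures` is proved by induction on the set `T` of coordinates of the form. The point
is that `ε` must not depend on the density of `B`. The ingredients are the following.

* A form in `T` that vanishes on many lines in a direction `t` has bounded partition rank. This is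
  the case of `T \ {t}`, for the family of forms obtained by fixing the coordinate `t`
  (`Captures.lowRank_of_biased`). With Cauchy-Schwarz, the forms that vanish on three quarters of a
  dense set are of bounded partition rank up to boundedly many translations
  (`Captures.exists_cover`), so one may assume that `r` has bounded partition rank.
* One may work modulo a bounded structured space: sums of `2 ^ |T|` points of a popular class of
  `B` are zeros of the structured forms, they are again dense, and `P(r(b) ≠ 0)` grows by a factor
  `2 ^ |T|` only (`exists_sums_vanishing`, `CapturesLow.modulo`).
* The products `φ ⊗ ψ` in a low rank decomposition of `r`, with `φ` in `J` and `ψ` in `T \ J`, are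
  eliminated one type `J` after the other, in the order of increasing size
  (`CapturesLow.of_erase`). Since the number of types depends on `T` only, so does the loss
  in `ε`.
-/

open scoped TensorProduct

noncomputable section

namespace RankOneClosed

/-! ### Multilinear forms in a subset of the variables -/

section Forms

variable {ι : Type} [DecidableEq ι] {V : ι → Type} [∀ i, AddCommGroup (V i)]

/-- The forms that are multilinear in the coordinates in `T` and do not depend on the others,
as functions of all coordinates, so that the tensor product of forms in disjoint sets of
coordinates is their pointwise product. Over `𝔽₂` additivity in a coordinate is linearity. -/
def MLin (V : ι → Type) [∀ i, AddCommGroup (V i)] (T : Finset ι) :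
    Submodule (ZMod 2) ((∀ i, V i) → ZMod 2) where
  carrier := {f | (∀ i ∈ T, ∀ x a b, f (Function.update x i (a + b)) =
      f (Function.update x i a) + f (Function.update x i b)) ∧
    ∀ i ∉ T, ∀ x a, f (Function.update x i a) = f x}
  add_mem' := by
    rintro f g ⟨hf, hf'⟩ ⟨hg, hg'⟩
    refine ⟨fun i hi x a b => ?_, fun i hi x a => ?_⟩
    · simp only [Pi.add_apply, hf i hi, hg i hi]; ring
    · simp only [Pi.add_apply, hf' i hi, hg' i hi]
  zero_mem' := by simp
  smul_mem' := by
    rintro c f ⟨hf, hf'⟩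
    refine ⟨fun i hi x a b => ?_, fun i hi x a => ?_⟩
    · simp only [Pi.smul_apply, hf i hi, smul_add]
    · simp only [Pi.smul_apply, hf' i hi]

variable {T I J K : Finset ι} {f g : (∀ i, V i) → ZMod 2}

theorem MLin.update_add (hf : f ∈ MLin V T) {i : ι} (hi : i ∈ T) (x : ∀ i, V i) (a b : V i) :
    f (Function.update x i (a + b)) =
      f (Function.update x i a) + f (Function.update x i b) := hf.1 i hi x a b

theorem MLin.update_of_notMem (hf : f ∈ MLin V T) {i : ι} (hi : i ∉ T) (x : ∀ i, V i) (a : V i) :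
    f (Function.update x i a) = f x := hf.2 i hi x a

theorem MLin.mul (hf : f ∈ MLin V I) (hg : g ∈ MLin V J) (h : Disjoint I J) :
    f * g ∈ MLin V (I ∪ J) := by
  refine ⟨fun i hi x a b => ?_, fun i hi x a => ?_⟩
  · simp only [Pi.mul_apply]
    rcases Finset.mem_union.1 hi with hi | hi
    · have hj : i ∉ J := Finset.disjoint_left.1 h hi
      rw [MLin.update_add hf hi]
      simp only [MLin.update_of_notMem hg hj]
      ring
    · have hj : i ∉ I := Finset.disjoint_right.1 h hi
      rw [MLin.update_add hg hi]
      simp only [MLin.update_of_notMem hf hj]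
      ring
  · rw [Finset.mem_union, not_or] at hi
    simp only [Pi.mul_apply, MLin.update_of_notMem hf hi.1, MLin.update_of_notMem hg hi.2]

theorem MLin.mul_sdiff (hf : f ∈ MLin V I) (hg : g ∈ MLin V (T \ I)) (h : I ⊆ T) :
    f * g ∈ MLin V T := by
  have := MLin.mul hf hg Finset.disjoint_sdiff
  rwa [Finset.union_sdiff_of_subset h] at this

theorem MLin.piecewise_of_disjoint (hf : f ∈ MLin V I) (s : Finset ι) (hs : Disjoint s I)
    (x y : ∀ i, V i) : f (s.piecewise x y) = f y := by
  induction s using Finset.induction_on with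
  | empty => simp
  | insert j s hj ih =>
    rw [Finset.disjoint_insert_left] at hs
    rw [Finset.piecewise_insert, MLin.update_of_notMem hf hs.1, ih hs.2]

theorem MLin.piecewise_of_subset [Fintype ι] (hf : f ∈ MLin V I) (s : Finset ι) (hs : I ⊆ s)
    (x y : ∀ i, V i) : f (s.piecewise x y) = f x := by
  rw [← Finset.piecewise_compl]
  exact MLin.piecewise_of_disjoint hf _ (Finset.disjoint_left.2 fun i hi h =>
    (Finset.mem_compl.1 hi) (hs h)) _ _

theorem MLin.apply_eq_of_empty [Fintype ι] (hf : f ∈ MLin V ∅) (x y : ∀ i, V i) :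
    f x = f y := by
  have := MLin.piecewise_of_subset hf Finset.univ (by simp) x y
  have h2 := MLin.piecewise_of_disjoint hf Finset.univ (by simp) x y
  rw [← this, h2]

/-- Fixing the coordinates in `J` of a form. -/
def contract (J : Finset ι) (b : ∀ i, V i) (f : (∀ i, V i) → ZMod 2) : (∀ i, V i) → ZMod 2 :=
  fun c => f (J.piecewise b c)

omit [∀ i, AddCommGroup (V i)] in
theorem contract_add (b : ∀ i, V i) : contract J b (f + g) = contract J b f + contract J b g := rfl

omit [∀ i, AddCommGroup (V i)] in
theorem contract_mul (b : ∀ i, V i) : contract J b (f * g) = contract J b f * contract J b g := rfl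

theorem MLin.contract (hf : f ∈ MLin V T) (J : Finset ι) (b : ∀ i, V i) :
    contract J b f ∈ MLin V (T \ J) := by
  refine ⟨fun i hi x a c => ?_, fun i hi x a => ?_⟩
  · rw [Finset.mem_sdiff] at hi
    simp only [RankOneClosed.contract, ← Finset.update_piecewise_of_notMem _ _ _ hi.2]
    exact MLin.update_add hf hi.1 _ _ _
  · simp only [RankOneClosed.contract]
    by_cases hJ : i ∈ J
    · congr 1
      ext j
      by_cases hj : j ∈ J
      · simp [hj]
      · have : j ≠ i := fun h => hj (h ▸ hJ)
        simp [hj, this]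
    · rw [← Finset.update_piecewise_of_notMem _ _ _ hJ, MLin.update_of_notMem hf]
      exact fun h => hi (Finset.mem_sdiff.2 ⟨h, hJ⟩)

theorem MLin.update_smul [∀ i, Module (ZMod 2) (V i)] (hf : f ∈ MLin V T) {i : ι} (hi : i ∈ T)
    (x : ∀ i, V i) (c : ZMod 2) (a : V i) :
    f (Function.update x i (c • a)) = c • f (Function.update x i a) := by
  let F : V i →+ ZMod 2 := AddMonoidHom.mk' (fun a => f (Function.update x i a))
    (MLin.update_add hf hi x)
  exact ZMod.map_smul F c a

theorem zmod_two_add_self (a : ZMod 2) : a + a = 0 := CharTwo.add_self_eq_zero a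

/-! ### Forms of low partition rank -/

/-- The nonempty subsets of `T` that avoid the distinguished element `t`. They index the
splittings of `T` into two nonempty parts, each represented by the part without `t`. -/
def properParts (T : Finset ι) (t : ι) : Finset (Finset ι) := (T.erase t).powerset.erase ∅

theorem mem_properParts {t : ι} : J ∈ properParts T t ↔ J.Nonempty ∧ J ⊆ T.erase t := by
  simp [properParts, Finset.nonempty_iff_ne_empty]

/-- `LowRank 𝒥 T l f`: the form `f` is a sum of at most `l` products `φ ψ`, in each of which `φ`
is a form in some `J ∈ 𝒥` and `ψ` is a form in `T \ J`. -/
inductive LowRank (𝒥 : Finset (Finset ι)) (T : Finset ι) : ℕ → ((∀ i, V i) → ZMod 2) → Prop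
  | zero (l : ℕ) : LowRank 𝒥 T l 0
  | add {l : ℕ} {J : Finset ι} {φ ψ f : (∀ i, V i) → ZMod 2} (hJ : J ∈ 𝒥) (hφ : φ ∈ MLin V J)
      (hψ : ψ ∈ MLin V (T \ J)) (hf : LowRank 𝒥 T l f) : LowRank 𝒥 T (l + 1) (φ * ψ + f)

variable {𝒥 : Finset (Finset ι)} {l m : ℕ}

theorem LowRank.mono (h : LowRank 𝒥 T l f) (hlm : l ≤ m) : LowRank 𝒥 T m f := by
  induction h generalizing m with
  | zero => exact .zero _
  | add hJ hφ hψ _ ih =>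
    obtain ⟨m, rfl⟩ := Nat.exists_eq_add_of_le' (Nat.le_of_add_left_le hlm)
    exact .add hJ hφ hψ (ih (by omega))

theorem LowRank.add_lowRank (hf : LowRank 𝒥 T l f) (hg : LowRank 𝒥 T m g) :
    LowRank 𝒥 T (l + m) (f + g) := by
  induction hf with
  | zero => simpa using hg.mono (by omega)
  | add hJ hφ hψ _ ih =>
    rw [Nat.add_right_comm, add_assoc (_ * _)]
    exact .add hJ hφ hψ ih

theorem LowRank.sum {κ : Type} (s : Finset κ) (F : κ → (∀ i, V i) → ZMod 2)
    (h : ∀ i ∈ s, LowRank 𝒥 T l (F i)) : LowRank 𝒥 T (s.card * l) (∑ i ∈ s, F i) := by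
  classical
  induction s using Finset.induction_on with
  | empty => simpa using LowRank.zero 0
  | insert a s ha ih =>
    rw [Finset.sum_insert ha, Finset.card_insert_of_notMem ha, add_mul, one_mul, add_comm (F a)]
    exact (ih fun i hi => h i (Finset.mem_insert_of_mem hi)).add_lowRank
      (h a (Finset.mem_insert_self _ _))

theorem LowRank.mem_MLin (h𝒥 : ∀ J ∈ 𝒥, J ⊆ T) (hf : LowRank 𝒥 T l f) : f ∈ MLin V T := by
  induction hf with
  | zero => exact zero_mem _
  | add hJ hφ hψ _ ih => exact add_mem (MLin.mul_sdiff hφ hψ (h𝒥 _ hJ)) ih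

/-- Separates the terms of one type `J` from those of the other types. -/
theorem LowRank.split (hf : LowRank 𝒥 T l f) (J : Finset ι) :
    ∃ (φ ψ : Fin l → (∀ i, V i) → ZMod 2) (g : (∀ i, V i) → ZMod 2),
      (∀ j, φ j ∈ MLin V J) ∧ (∀ j, ψ j ∈ MLin V (T \ J)) ∧ LowRank (𝒥.erase J) T l g ∧
      f = ∑ j, φ j * ψ j + g := by
  induction hf with
  | zero => exact ⟨0, 0, 0, fun _ => zero_mem _, fun _ => zero_mem _, .zero _, by simp⟩
  | @add l J' φ' ψ' f hJ hφ hψ hf ih =>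
    obtain ⟨φ, ψ, g, h1, h2, h3, rfl⟩ := ih
    by_cases h : J' = J
    · subst h
      refine ⟨Fin.cons φ' φ, Fin.cons ψ' ψ, g, Fin.cases hφ h1, Fin.cases hψ h2,
        h3.mono (by omega), ?_⟩
      rw [Fin.sum_univ_succ]
      simp [add_assoc]
    · refine ⟨Fin.cons 0 φ, Fin.cons 0 ψ, φ' * ψ' + g, Fin.cases (zero_mem _) h1,
        Fin.cases (zero_mem _) h2, .add (Finset.mem_erase.2 ⟨h, hJ⟩) hφ hψ h3, ?_⟩
      rw [Fin.sum_univ_succ]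
      simp only [Fin.cons_zero, Fin.cons_succ, mul_zero, zero_add]
      abel

theorem LowRank.contract {t : ι} (hf : LowRank 𝒥 T l f)
    (h𝒥 : ∀ K ∈ 𝒥, K ⊆ T.erase t ∧ ¬ K ⊆ J) (b : ∀ i, V i) :
    LowRank (properParts (T \ J) t) (T \ J) l (contract J b f) := by
  induction hf with
  | zero => exact .zero _
  | @add l K φ ψ f hK hφ hψ hf ih =>
    rw [contract_add, contract_mul]
    refine .add (J := K \ J) ?_ (MLin.contract hφ J b) ?_ ih
    · rw [mem_properParts, Finset.sdiff_nonempty]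
      refine ⟨(h𝒥 K hK).2, fun i hi => ?_⟩
      have := (h𝒥 K hK).1 (Finset.mem_sdiff.1 hi).1
      simp only [Finset.mem_erase, Finset.mem_sdiff] at this hi ⊢
      tauto
    · have : (T \ J) \ (K \ J) = (T \ K) \ J := by
        ext i; simp only [Finset.mem_sdiff]; tauto
      rw [this]
      exact MLin.contract hψ J b

theorem LowRank.mul {t : ι} (hφ : g ∈ MLin V J)
    (hf : LowRank (properParts (T \ J) t) (T \ J) l f)
    (h𝒥 : ∀ K ∈ properParts (T \ J) t, J ∪ K ∈ 𝒥) :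
    LowRank 𝒥 T l (g * f) := by
  induction hf with
  | zero => simpa using .zero _
  | @add l K φ ψ f hK hφ hψ hf ih =>
    rw [mul_add, ← mul_assoc]
    refine .add (h𝒥 K hK) (MLin.mul ‹_› hφ ?_) ?_ ih
    · rw [mem_properParts] at hK
      refine Finset.disjoint_left.2 fun i hi hi' => ?_
      have := hK.2 hi'
      simp only [Finset.mem_erase, Finset.mem_sdiff] at this
      tauto
    · rwa [sdiff_sdiff_left] at hψ

theorem LowRank.of_empty (hf : LowRank ∅ T l f) : f = 0 := by
  cases hf with
  | zero => rfl
  | add hJ => simp at hJ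

/-! ### Structured spaces of forms -/

/-- A family of pairs `(I, σ)` in which `σ` is a form in a nonempty `I ⊆ T`. -/
def Admissible (T : Finset ι) (𝒮 : Finset (Finset ι × ((∀ i, V i) → ZMod 2))) : Prop :=
  ∀ s ∈ 𝒮, s.1.Nonempty ∧ s.1 ⊆ T ∧ s.2 ∈ MLin V s.1

/-- The space `∑ σ ⊗ (forms in T \ I)`, summed over the pairs `(I, σ)` of the family `𝒮`. -/
def tspan (T : Finset ι) (𝒮 : Finset (Finset ι × ((∀ i, V i) → ZMod 2))) :
    Submodule (ZMod 2) ((∀ i, V i) → ZMod 2) :=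
  Submodule.span (ZMod 2) {g | ∃ s ∈ 𝒮, ∃ ψ ∈ MLin V (T \ s.1), g = s.2 * ψ}

variable {𝒮 𝒯 : Finset (Finset ι × ((∀ i, V i) → ZMod 2))}

theorem mul_mem_tspan {s : Finset ι × ((∀ i, V i) → ZMod 2)} (hs : s ∈ 𝒮)
    (hg : g ∈ MLin V (T \ s.1)) : s.2 * g ∈ tspan T 𝒮 :=
  Submodule.subset_span ⟨s, hs, g, hg, rfl⟩

theorem tspan_mono (h : 𝒮 ⊆ 𝒯) : tspan T 𝒮 ≤ tspan T 𝒯 :=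
  Submodule.span_mono fun _ ⟨s, hs, ψ, hψ, e⟩ => ⟨s, h hs, ψ, hψ, e⟩

theorem tspan_apply_eq_zero (hf : f ∈ tspan T 𝒮) (x : ∀ i, V i) (hx : ∀ s ∈ 𝒮, s.2 x = 0) :
    f x = 0 := by
  induction hf using Submodule.span_induction with
  | mem f hf =>
    obtain ⟨s, hs, ψ, -, rfl⟩ := hf
    simp [hx s hs]
  | zero => rfl
  | add f g _ _ hf hg => simp [hf, hg]
  | smul c f _ hf => simp [hf]

/-- Multiplication by a form in `T \ J` carries structured forms in `J` to structured forms
in `T`. -/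
theorem tspan_mul (hJ : J ⊆ T) (h𝒮 : Admissible J 𝒮) (hf : f ∈ tspan J 𝒮)
    (hg : g ∈ MLin V (T \ J)) : f * g ∈ tspan T 𝒮 := by
  induction hf using Submodule.span_induction with
  | mem f hf =>
    obtain ⟨s, hs, ψ, hψ, rfl⟩ := hf
    rw [mul_assoc]
    refine mul_mem_tspan hs ?_
    have h1 := MLin.mul hψ hg (Finset.disjoint_left.2 fun i hi hi' =>
      (Finset.mem_sdiff.1 hi').2 (Finset.mem_sdiff.1 hi).1)
    have : J \ s.1 ∪ T \ J = T \ s.1 := by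
      ext i
      have := @hJ i
      have := @(h𝒮 s hs).2.1 i
      simp only [Finset.mem_union, Finset.mem_sdiff]
      tauto
    rwa [this] at h1
  | zero => simp
  | add f g _ _ hf hg => rw [add_mul]; exact add_mem hf hg
  | smul c f _ hf => rw [smul_mul_assoc]; exact Submodule.smul_mem _ _ hf

theorem Admissible.union (h𝒮 : Admissible T 𝒮) (h𝒯 : Admissible T 𝒯)
    [DecidableEq (Finset ι × ((∀ i, V i) → ZMod 2))] : Admissible T (𝒮 ∪ 𝒯) := by
  intro s hs
  rcases Finset.mem_union.1 hs with h | h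
  exacts [h𝒮 s h, h𝒯 s h]

theorem Admissible.mono (h𝒮 : Admissible J 𝒮) (h : J ⊆ T) : Admissible T 𝒮 :=
  fun s hs => ⟨(h𝒮 s hs).1, (h𝒮 s hs).2.1.trans h, (h𝒮 s hs).2.2⟩

end Forms

/-! ### Weighted families -/

section Mass

open Classical in
/-- The total weight of the indices with the property `P`. -/
def mass {Ω : Type} [Fintype Ω] (w : Ω → ℝ) (P : Ω → Prop) : ℝ := ∑ ω with P ω, w ω

variable {Ω : Type} [Fintype Ω] {w : Ω → ℝ} {P Q R : Ω → Prop}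

open Classical in
theorem mass_eq_sum_ite : mass w P = ∑ ω, if P ω then w ω else 0 := by
  rw [mass, Finset.sum_filter]

theorem mass_nonneg (hw : ∀ ω, 0 ≤ w ω) : 0 ≤ mass w P := Finset.sum_nonneg fun _ _ => hw _

theorem mass_mono (hw : ∀ ω, 0 ≤ w ω) (h : ∀ ω, P ω → Q ω) : mass w P ≤ mass w Q := by
  classical
  refine Finset.sum_le_sum_of_subset_of_nonneg (fun ω hω => ?_) fun _ _ _ => hw _
  simp only [Finset.mem_filter] at hω ⊢
  exact ⟨hω.1, h ω hω.2⟩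

theorem mass_le_add (hw : ∀ ω, 0 ≤ w ω) (h : ∀ ω, P ω → Q ω ∨ R ω) :
    mass w P ≤ mass w Q + mass w R := by
  classical
  simp only [mass_eq_sum_ite, ← Finset.sum_add_distrib]
  refine Finset.sum_le_sum fun ω _ => ?_
  have := hw ω
  have := h ω
  split_ifs <;> first | simp; done | linarith | (exfalso; tauto)

theorem mass_le_sum (hw : ∀ ω, 0 ≤ w ω) : mass w P ≤ ∑ ω, w ω := by
  classical
  exact Finset.sum_le_sum_of_subset_of_nonneg (Finset.filter_subset _ _) fun _ _ _ => hw _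

theorem mass_add_mass_not : mass w P + mass w (fun ω => ¬ P ω) = ∑ ω, w ω := by
  classical
  simp only [mass_eq_sum_ite, ← Finset.sum_add_distrib]
  refine Finset.sum_congr rfl fun ω _ => ?_
  by_cases h : P ω <;> simp [h]

theorem mass_eq_zero (h : ∀ ω, ¬ P ω) : mass w P = 0 := by
  classical
  rw [mass, Finset.filter_false_of_mem fun ω _ => h ω, Finset.sum_empty]

theorem mass_prod {Ω' : Type} [Fintype Ω'] (u : Ω × Ω' → ℝ) (P : Ω × Ω' → Prop) :
    mass u P = ∑ ω, mass (fun a => u (ω, a)) (fun a => P (ω, a)) := by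
  classical
  simp only [mass_eq_sum_ite, Fintype.sum_prod_type]

theorem mass_comp_equiv (e : Ω ≃ Ω) (c : ℝ) :
    mass (fun _ => c) (fun ω => P (e ω)) = mass (fun _ => c) P := by
  classical
  simp only [mass_eq_sum_ite]
  exact Equiv.sum_comp e fun ω => if P ω then c else 0

/-- A property that holds at `ω` or at `e ω`, for each `ω`, has at least half of the mass. -/
theorem card_mul_le_two_mul_mass (e : Ω ≃ Ω) {c : ℝ} (hc : 0 ≤ c) (h : ∀ ω, P ω ∨ P (e ω)) :
    Fintype.card Ω * c ≤ 2 * mass (fun _ => c) P := by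
  have h1 := mass_add_mass_not (w := fun _ : Ω => c) (P := P)
  have h2 : mass (fun _ => c) (fun ω => ¬ P ω) ≤ mass (fun _ => c) (fun ω => P (e ω)) :=
    mass_mono (fun _ => hc) fun ω hω => (h ω).resolve_left hω
  rw [mass_comp_equiv] at h2
  simp only [Finset.sum_const, nsmul_eq_mul, Finset.card_univ] at h1
  linarith

/-- Markov's inequality for the number of `s ∈ S` at which a property fails. -/
theorem mass_markov {X : Type} (S : Finset X) (E : Ω → X → Prop) (hw : ∀ ω, 0 ≤ w ω) (ε c : ℝ)
    (hS : ∀ s ∈ S, mass w (fun ω => E ω s) ≤ ε) (Q : Ω → Prop)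
    (hQ : ∀ ω, Q ω → c * S.card ≤ mass (fun _ : S => (1 : ℝ)) (fun s => E ω s)) :
    c * S.card * mass w Q ≤ ε * S.card := by
  classical
  calc c * S.card * mass w Q = ∑ ω, if Q ω then (c * S.card) * w ω else 0 := by
        rw [mass_eq_sum_ite, Finset.mul_sum]
        simp only [mul_ite, mul_zero]
    _ ≤ ∑ ω, w ω * mass (fun _ : S => (1 : ℝ)) (fun s => E ω s) := by
        refine Finset.sum_le_sum fun ω _ => ?_
        split_ifs with h
        · rw [mul_comm]; exact mul_le_mul_of_nonneg_left (hQ ω h) (hw ω)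
        · exact mul_nonneg (hw ω) (mass_nonneg fun _ => zero_le_one)
    _ = ∑ s : S, mass w (fun ω => E ω s) := by
        simp only [mass_eq_sum_ite, Finset.mul_sum]
        rw [Finset.sum_comm]
        refine Finset.sum_congr rfl fun s _ => Finset.sum_congr rfl fun ω _ => ?_
        simp
    _ ≤ ∑ s : S, ε := Finset.sum_le_sum fun s _ => hS s s.2
    _ = ε * S.card := by simp [mul_comm]

end Mass

/-! ### Families of forms that almost vanish on a dense set -/

section Capture

variable {ι : Type} [Fintype ι] [DecidableEq ι]

/-- A weighted family of forms in `T`, of total weight at most `1`, and a set `B` of density at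
least `δ`, such that at each point of `B` all but weight `ε` of the forms vanish. -/
structure AlmostVanishing {V : ι → Type} [∀ i, AddCommGroup (V i)] [∀ i, Fintype (V i)]
    {Ω : Type} [Fintype Ω] (T : Finset ι) (δ ε : ℝ) (w : Ω → ℝ)
    (r : Ω → (∀ i, V i) → ZMod 2) (B : Finset (∀ i, V i)) : Prop where
  nonneg : ∀ ω, 0 ≤ w ω
  sum_le_one : ∑ ω, w ω ≤ 1
  mem : ∀ ω, r ω ∈ MLin V T
  dense : δ * Fintype.card (∀ i, V i) ≤ B.card
  vanish : ∀ b ∈ B, mass w (fun ω => r ω b ≠ 0) ≤ ε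

/-- A weighted family of forms in `T` that almost vanishes on a dense set is, up to weight `η`,
contained in a structured space. The point is that `ε` depends on `η` only, and not on the
density `δ`, while the complexity `k` of the structured space does not depend on the spaces. -/
def Captures (T : Finset ι) : Prop :=
  ∀ η : ℝ, 0 < η → ∃ ε : ℝ, 0 < ε ∧ ∀ δ : ℝ, 0 < δ → ∃ k : ℕ,
    ∀ (V : ι → Type) [∀ i, AddCommGroup (V i)] [∀ i, Module (ZMod 2) (V i)] [∀ i, Fintype (V i)]
      (Ω : Type) [Fintype Ω] (w : Ω → ℝ) (r : Ω → (∀ i, V i) → ZMod 2) (B : Finset (∀ i, V i)),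
      AlmostVanishing T δ ε w r B →
      ∃ 𝒮 : Finset (Finset ι × ((∀ i, V i) → ZMod 2)), 𝒮.card ≤ k ∧ Admissible T 𝒮 ∧
        mass w (fun ω => r ω ∉ tspan T 𝒮) ≤ η

/-- The variant of `Captures` for families of forms of partition rank at most `l`, of types
in `𝒥`. Here `ε` does not depend on `l` either. -/
def CapturesLow (𝒥 : Finset (Finset ι)) (T : Finset ι) : Prop :=
  ∀ η : ℝ, 0 < η → ∃ ε : ℝ, 0 < ε ∧ ∀ δ : ℝ, 0 < δ → ∀ l : ℕ, ∃ k : ℕ,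
    ∀ (V : ι → Type) [∀ i, AddCommGroup (V i)] [∀ i, Module (ZMod 2) (V i)] [∀ i, Fintype (V i)]
      (Ω : Type) [Fintype Ω] (w : Ω → ℝ) (r : Ω → (∀ i, V i) → ZMod 2) (B : Finset (∀ i, V i)),
      AlmostVanishing T δ ε w r B → (∀ ω, LowRank 𝒥 T l (r ω)) →
      ∃ 𝒮 : Finset (Finset ι × ((∀ i, V i) → ZMod 2)), 𝒮.card ≤ k ∧ Admissible T 𝒮 ∧
        mass w (fun ω => r ω ∉ tspan T 𝒮) ≤ η

theorem captures_empty : Captures (∅ : Finset ι) := by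
  intro η hη
  refine ⟨η, hη, fun δ hδ => ⟨0, ?_⟩⟩
  intro V _ _ _ Ω _ w r B h
  refine ⟨∅, le_rfl, by simp [Admissible], ?_⟩
  have hB : 0 < B.card := by
    have h1 : (0 : ℝ) < Fintype.card (∀ i, V i) := by exact_mod_cast Fintype.card_pos
    have := h.dense
    have : (0 : ℝ) < B.card := by nlinarith
    exact_mod_cast this
  obtain ⟨b, hb⟩ := Finset.card_pos.1 hB
  refine (mass_mono h.nonneg fun ω hω h0 => hω ?_).trans (h.vanish b hb)
  have : r ω = 0 := funext fun x => by
    rw [MLin.apply_eq_of_empty (h.mem ω) x b, h0]; rfl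
  rw [this]
  exact zero_mem _

theorem capturesLow_empty (T : Finset ι) : CapturesLow ∅ T := by
  intro η hη
  refine ⟨1, one_pos, fun δ hδ l => ⟨0, ?_⟩⟩
  intro V _ _ _ Ω _ w r B h hr
  refine ⟨∅, le_rfl, by simp [Admissible], ?_⟩
  refine le_trans (le_of_eq ?_) hη.le
  rw [mass]
  refine Finset.sum_eq_zero fun ω hω => ?_
  simp [(hr ω).of_empty] at hω

/-- A family of tuples of forms, each of which almost vanishes simultaneously, is captured by
applying `Captures` to random linear combinations. The length of the tuples does not matter. -/
theorem Captures.tuple {T : Finset ι} (h : Captures T) :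
    ∀ η : ℝ, 0 < η → ∃ ε : ℝ, 0 < ε ∧ ∀ δ : ℝ, 0 < δ → ∃ k : ℕ,
    ∀ (V : ι → Type) [∀ i, AddCommGroup (V i)] [∀ i, Module (ZMod 2) (V i)] [∀ i, Fintype (V i)]
      (Ω : Type) [Fintype Ω] (w : Ω → ℝ) (p : ℕ) (r : Ω → Fin p → (∀ i, V i) → ZMod 2)
      (B : Finset (∀ i, V i)),
      (∀ ω, 0 ≤ w ω) → ∑ ω, w ω ≤ 1 → (∀ ω j, r ω j ∈ MLin V T) →
      δ * Fintype.card (∀ i, V i) ≤ B.card →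
      (∀ b ∈ B, mass w (fun ω => ∃ j, r ω j b ≠ 0) ≤ ε) →
      ∃ 𝒮 : Finset (Finset ι × ((∀ i, V i) → ZMod 2)), 𝒮.card ≤ k ∧ Admissible T 𝒮 ∧
        mass w (fun ω => ∃ j, r ω j ∉ tspan T 𝒮) ≤ η := by
  intro η hη
  obtain ⟨ε, hε, H⟩ := h (η / 2) (by positivity)
  refine ⟨ε, hε, fun δ hδ => ?_⟩
  obtain ⟨k, H⟩ := H δ hδ
  refine ⟨k, ?_⟩
  intro V _ _ _ Ω _ w p r B hw hw1 hr hB hv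
  classical
  have hcard : (0 : ℝ) < Fintype.card (Fin p → ZMod 2) := by exact_mod_cast Fintype.card_pos
  obtain ⟨𝒮, h1, h2, h3⟩ := H V (Ω × (Fin p → ZMod 2))
    (fun q => w q.1 / Fintype.card (Fin p → ZMod 2)) (fun q => ∑ j, q.2 j • r q.1 j) B
    { nonneg := fun q => div_nonneg (hw _) hcard.le
      sum_le_one := by
        rw [Fintype.sum_prod_type]
        simp only [Finset.sum_const, nsmul_eq_mul, Finset.card_univ]
        refine le_trans (le_of_eq (Finset.sum_congr rfl fun ω _ => ?_)) hw1
        field_simp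
      mem := fun q => Submodule.sum_mem _ fun j _ => Submodule.smul_mem _ _ (hr _ _)
      dense := hB
      vanish := by
        intro b hb
        refine le_trans ?_ (hv b hb)
        rw [mass_prod, mass_eq_sum_ite]
        refine Finset.sum_le_sum fun ω _ => ?_
        split_ifs with hω
        · refine (mass_le_sum fun _ => div_nonneg (hw ω) hcard.le).trans (le_of_eq ?_)
          simp only [Finset.sum_const, nsmul_eq_mul, Finset.card_univ]
          field_simp
        · push Not at hω
          refine (mass_eq_zero fun a => ?_).le
          simp [Finset.sum_apply, hω] }
  refine ⟨𝒮, h1, h2, ?_⟩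
  suffices mass w (fun ω => ∃ j, r ω j ∉ tspan T 𝒮) ≤ 2 * (η / 2) by linarith
  refine le_trans ?_ (mul_le_mul_of_nonneg_left h3 zero_le_two)
  rw [mass_eq_sum_ite, mass_prod, Finset.mul_sum]
  refine Finset.sum_le_sum fun ω _ => ?_
  have hnn := div_nonneg (hw ω) hcard.le
  split_ifs with hω
  · obtain ⟨j, hj⟩ := hω
    -- flipping the coefficient of the form outside the space leads out of the space
    let e : (Fin p → ZMod 2) ≃ (Fin p → ZMod 2) := Equiv.addRight (Pi.single j 1)
    refine le_trans (le_of_eq ?_) (card_mul_le_two_mul_mass e hnn fun a => ?_)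
    · field_simp
    · by_contra! hcon
      apply hj
      have := sub_mem hcon.2 hcon.1
      rw [← Finset.sum_sub_distrib] at this
      simp only [e, Equiv.coe_addRight, Pi.add_apply, add_smul, add_sub_cancel_left] at this
      rwa [Finset.sum_eq_single j (by intro i _ hi; simp [hi]) (by simp), Pi.single_eq_same,
        one_smul] at this
  · exact mul_nonneg zero_le_two (mass_nonneg fun _ => hnn)

/-! ### Passing to a dense set on which given forms vanish -/

section Sums

variable {V : ι → Type} [∀ i, AddCommGroup (V i)] [∀ i, Fintype (V i)]

omit [Fintype ι] [∀ i, Fintype (V i)] in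
/-- Adding two points of `B` that differ in the coordinate `i` only, in that coordinate. On each
line this is the sumset of `B` with itself, so it is no smaller than `B`. -/
theorem exists_coordinate_sums (B : Finset (∀ i, V i)) (i : ι) :
    ∃ B' : Finset (∀ i, V i), B.card ≤ B'.card ∧ ∀ x ∈ B', ∃ a a' : V i,
      Function.update x i a ∈ B ∧ Function.update x i a' ∈ B ∧ a + a' = x i := by
  classical
  have h0 : ∀ z : ∀ i, V i, ∃ a, (∃ a, Function.update z i a ∈ B) → Function.update z i a ∈ B :=
    fun z => by
      by_cases h : ∃ a, Function.update z i a ∈ B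
      · exact ⟨h.choose, fun _ => h.choose_spec⟩
      · exact ⟨0, fun h' => absurd h' h⟩
  choose s hs using h0
  refine ⟨B.image fun x => Function.update x i (x i + s (Function.update x i 0)), ?_, ?_⟩
  · refine (Finset.card_image_of_injective _ fun x y hxy => ?_).ge
    have h1 : Function.update x i 0 = Function.update y i 0 := by
      have := congrArg (fun z => Function.update z i 0) hxy
      simpa using this
    have h2 : x i = y i := by
      have := congrFun hxy i
      simpa [h1] using this
    ext j
    by_cases hj : j = i
    · subst hj; exact h2
    · simpa [hj] using congrFun h1 j
  · intro y hy
    obtain ⟨x, hx, rfl⟩ := Finset.mem_image.1 hy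
    refine ⟨x i, s (Function.update x i 0), by simpa using hx, ?_, by simp⟩
    have := hs (Function.update x i 0) ⟨x i, by simpa using hx⟩
    simpa using this

omit [Fintype ι] [∀ i, Fintype (V i)] in
/-- From a dense set `B` one can pass to a dense set of sums of points of `B` on which the forms
of `𝒮` vanish: restrict to a popular class of `B` with respect to the values of the forms of `𝒮`,
and take sums in each coordinate in turn. The first such sum that involves a coordinate of a form
makes this form vanish, since `𝔽₂` has characteristic two. -/
theorem exists_sums_vanishing {T : Finset ι} (B : Finset (∀ i, V i))
    (𝒮 : Finset (Finset ι × ((∀ i, V i) → ZMod 2))) (h𝒮 : Admissible T 𝒮)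
    {Ω : Type} [Fintype Ω] (w : Ω → ℝ) (r : Ω → (∀ i, V i) → ZMod 2) (hw : ∀ ω, 0 ≤ w ω)
    (hr : ∀ ω, r ω ∈ MLin V T) (ε : ℝ) (hB : ∀ b ∈ B, mass w (fun ω => r ω b ≠ 0) ≤ ε) :
    ∃ B' : Finset (∀ i, V i), B.card ≤ 2 ^ 𝒮.card * B'.card ∧ (∀ b ∈ B', ∀ s ∈ 𝒮, s.2 b = 0) ∧
      ∀ b ∈ B', mass w (fun ω => r ω b ≠ 0) ≤ 2 ^ T.card * ε := by
  classical
  obtain ⟨c, hc⟩ : ∃ c : 𝒮 → ZMod 2,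
      B.card ≤ 2 ^ 𝒮.card * (B.filter fun b => (fun s : 𝒮 => s.1.2 b) = c).card := by
    by_contra! hcon
    have h1 := Finset.card_eq_sum_card_fiberwise (s := B) (t := Finset.univ)
      (f := fun b => (fun s : 𝒮 => s.1.2 b)) (fun _ _ => Finset.mem_coe.2 (Finset.mem_univ _))
    have h2 := Finset.sum_lt_sum_of_nonempty (s := (Finset.univ : Finset (𝒮 → ZMod 2)))
      Finset.univ_nonempty fun c _ => hcon c
    rw [← Finset.mul_sum, ← h1] at h2
    simp at h2
  have key : ∀ U : Finset ι, U ⊆ T → ∃ B' : Finset (∀ i, V i),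
      (B.filter fun b => (fun s : 𝒮 => s.1.2 b) = c).card ≤ B'.card ∧
      (∀ b ∈ B', ∀ s : 𝒮, (Disjoint s.1.1 U → s.1.2 b = c s) ∧
        (¬ Disjoint s.1.1 U → s.1.2 b = 0)) ∧
      ∀ b ∈ B', mass w (fun ω => r ω b ≠ 0) ≤ 2 ^ U.card * ε := by
    intro U
    induction U using Finset.induction_on with
    | empty =>
      intro _
      refine ⟨_, le_rfl, fun b hb s => ⟨fun _ => ?_, fun h =>
        absurd (Finset.disjoint_empty_right _) h⟩, fun b hb => ?_⟩
      · exact congrFun (Finset.mem_filter.1 hb).2 s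
      · simpa using hB b (Finset.mem_filter.1 hb).1
    | insert i U hi ih =>
      intro hU
      obtain ⟨B1, h1, h2, h3⟩ := ih ((Finset.subset_insert _ _).trans hU)
      obtain ⟨B2, h4, h5⟩ := exists_coordinate_sums B1 i
      refine ⟨B2, h1.trans h4, fun b hb s => ?_, fun b hb => ?_⟩
      · obtain ⟨a, a', ha, ha', e⟩ := h5 b hb
        have hs := (h𝒮 s.1 s.2).2.2
        have hval : s.1.2 (Function.update b i a) = s.1.2 (Function.update b i a') := by
          by_cases hd : Disjoint s.1.1 U
          · rw [(h2 _ ha s).1 hd, (h2 _ ha' s).1 hd]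
          · rw [(h2 _ ha s).2 hd, (h2 _ ha' s).2 hd]
        rw [Finset.disjoint_insert_right]
        by_cases his : i ∈ s.1.1
        · refine ⟨fun h => absurd his h.1, fun _ => ?_⟩
          have := MLin.update_add hs his b a a'
          rwa [e, Function.update_eq_self, hval, zmod_two_add_self] at this
        · rw [← MLin.update_of_notMem hs his b a]
          simpa [his] using h2 _ ha s
      · obtain ⟨a, a', ha, ha', e⟩ := h5 b hb
        rw [Finset.card_insert_of_notMem hi, pow_succ]
        have : mass w (fun ω => r ω b ≠ 0) ≤ mass w (fun ω => r ω (Function.update b i a) ≠ 0) +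
            mass w (fun ω => r ω (Function.update b i a') ≠ 0) := by
          refine mass_le_add hw fun ω hω => ?_
          by_contra! hcon
          have := MLin.update_add (hr ω) (hU (Finset.mem_insert_self _ _)) b a a'
          rw [e, Function.update_eq_self, hcon.1, hcon.2, add_zero] at this
          exact hω this
        have := h3 _ ha
        have := h3 _ ha'
        linarith
  obtain ⟨B', h1, h2, h3⟩ := key T subset_rfl
  refine ⟨B', hc.trans (Nat.mul_le_mul_left _ h1), fun b hb s hs => ?_, h3⟩
  refine (h2 b hb ⟨s, hs⟩).2 fun hd => ?_
  obtain ⟨i, hi⟩ := (h𝒮 s hs).1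
  exact Finset.disjoint_left.1 hd hi ((h𝒮 s hs).2.1 hi)

end Sums

/-! ### Biased forms have low partition rank -/

/-- A form in `T` that vanishes on a positive proportion of the lines in direction `t` has
bounded partition rank: the forms obtained by fixing the coordinate `t` all vanish on a common
dense set. -/
theorem Captures.lowRank_of_biased {T : Finset ι} {t : ι} (ht : t ∈ T)
    (h : Captures (T.erase t)) (κ : ℝ) (hκ : 0 < κ) : ∃ l : ℕ,
    ∀ (V : ι → Type) [∀ i, AddCommGroup (V i)] [∀ i, Module (ZMod 2) (V i)] [∀ i, Fintype (V i)]
      (f : (∀ i, V i) → ZMod 2) (B : Finset (∀ i, V i)), f ∈ MLin V T →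
      κ * Fintype.card (∀ i, V i) ≤ B.card → (∀ b ∈ B, ∀ v, f (Function.update b t v) = 0) →
      LowRank (properParts T t) T l f := by
  classical
  obtain ⟨ε, hε, H⟩ := h (1 / 3) (by norm_num)
  obtain ⟨k, H⟩ := H κ hκ
  refine ⟨k, ?_⟩
  intro V _ _ _ f B hf hB hv
  have hcard : (0 : ℝ) < Fintype.card (V t) := by exact_mod_cast Fintype.card_pos
  let R : V t →ₗ[ZMod 2] ((∀ i, V i) → ZMod 2) :=
    { toFun := fun v x => f (Function.update x t v)
      map_add' := fun a b => funext fun x => MLin.update_add hf ht x a b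
      map_smul' := fun c a => funext fun x => MLin.update_smul hf ht x c a }
  have hR : ∀ v, R v ∈ MLin V (T.erase t) := by
    intro v
    refine ⟨fun i hi x a b => ?_, fun i hi x a => ?_⟩
    · have hit := (Finset.mem_erase.1 hi).1
      simp only [R, LinearMap.coe_mk, AddHom.coe_mk, Function.update_comm hit]
      exact MLin.update_add hf (Finset.mem_erase.1 hi).2 _ _ _
    · simp only [R, LinearMap.coe_mk, AddHom.coe_mk]
      by_cases hit : i = t
      · subst hit; simp
      · rw [Function.update_comm hit, MLin.update_of_notMem hf]
        exact fun h => hi (Finset.mem_erase.2 ⟨hit, h⟩)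
  obtain ⟨𝒮, h1, h2, h3⟩ := H V (V t) (fun _ => 1 / Fintype.card (V t)) (fun v => R v) B
    { nonneg := fun _ => by positivity
      sum_le_one := by simp
      mem := hR
      dense := hB
      vanish := fun b hb => by
        refine le_of_eq_of_le (mass_eq_zero fun v hv' => ?_) hε.le
        exact hv' (hv b hb v) }
  have hall : ∀ v, R v ∈ tspan (T.erase t) 𝒮 := by
    by_contra! hcon
    obtain ⟨v, hv⟩ := hcon
    have h4 := card_mul_le_two_mul_mass (P := fun u => R u ∉ tspan (T.erase t) 𝒮)
      (c := 1 / Fintype.card (V t)) (Equiv.addRight v) (by positivity) fun u => by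
        by_contra! h'
        refine hv ((Submodule.add_mem_iff_right _ h'.1).1 ?_)
        rw [← map_add]
        exact h'.2
    rw [mul_one_div_cancel hcard.ne'] at h4
    linarith
  -- the coefficients can be chosen to depend linearly on the coordinate `t`
  let π : ((s : 𝒮) → MLin V (T.erase t \ s.1.1)) →ₗ[ZMod 2] ((∀ i, V i) → ZMod 2) :=
    { toFun := fun ψ => ∑ s, s.1.2 * (ψ s : (∀ i, V i) → ZMod 2)
      map_add' := fun a b => by
        rw [← Finset.sum_add_distrib]
        exact Finset.sum_congr rfl fun s _ => mul_add _ _ _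
      map_smul' := fun c a => by
        rw [RingHom.id_apply, Finset.smul_sum]
        exact Finset.sum_congr rfl fun s _ => mul_smul_comm _ _ _ }
  have hπ : tspan (T.erase t) 𝒮 ≤ LinearMap.range π := by
    refine Submodule.span_le.2 ?_
    rintro _ ⟨s, hs, ψ, hψ, rfl⟩
    refine ⟨Pi.single ⟨s, hs⟩ ⟨ψ, hψ⟩, ?_⟩
    refine (Finset.sum_eq_single (⟨s, hs⟩ : 𝒮) ?_ ?_).trans ?_
    · intro s' _ hs'
      rw [Pi.single_eq_of_ne hs']
      simp
    · simp
    · simp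
  obtain ⟨g, hg⟩ := Module.projective_lifting_property π.rangeRestrict
    (R.codRestrict (LinearMap.range π) fun v => hπ (hall v)) (LinearMap.surjective_rangeRestrict π)
  have hg' : ∀ v, ∑ s, s.1.2 * (g v s : (∀ i, V i) → ZMod 2) = R v := fun v =>
    congrArg Subtype.val (LinearMap.congr_fun hg v)
  have hts : ∀ s : 𝒮, t ∉ s.1.1 := fun s hs => by simpa using (h2 s.1 s.2).2.1 hs
  have hf' : f = ∑ s : 𝒮, s.1.2 * (fun x => (g (x t) s : (∀ i, V i) → ZMod 2) x) := by
    ext x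
    have := congrFun (hg' (x t)) x
    simp only [R, LinearMap.coe_mk, AddHom.coe_mk, Function.update_eq_self] at this
    rw [← this]
    simp
  rw [hf']
  refine (LowRank.sum (l := 1) Finset.univ _ fun s _ => ?_).mono (m := k) (by simpa using h1)
  rw [← add_zero (_ * _)]
  refine .add (J := s.1.1) (mem_properParts.2 ⟨(h2 _ s.2).1, (h2 _ s.2).2.1⟩) (h2 _ s.2).2.2 ?_
    (.zero 0)
  have hgs : ∀ v, (g v s : (∀ i, V i) → ZMod 2) ∈ MLin V (T.erase t \ s.1.1) := fun v => (g v s).2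
  have htn : t ∉ T.erase t \ s.1.1 := by simp
  refine ⟨fun i hi x a b => ?_, fun i hi x a => ?_⟩
  · by_cases hit : i = t
    · subst hit
      simp only [Function.update_self, MLin.update_of_notMem (hgs _) htn]
      rw [map_add]
      rfl
    · simp only [Function.update_of_ne (Ne.symm hit)]
      refine MLin.update_add (hgs _) ?_ _ _ _
      simpa [hit] using hi
  · have hit : i ≠ t := fun h => hi (by subst h; simp [ht, hts s])
    simp only [Function.update_of_ne hit.symm]
    refine MLin.update_of_notMem (hgs _) ?_ _ _
    simpa [hit] using hi

end Capture

/-! ### Covering the forms that are biased on a dense set -/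

/-- If among any `N + 1` objects with the property `P` some two are related, then all of them are
related to one of at most `N` of them. -/
theorem exists_net {α : Type} (P : α → Prop) (R : α → α → Prop) (hsymm : ∀ x y, R x y → R y x)
    (N : ℕ) (h : ∀ Y : Finset α, (∀ y ∈ Y, P y) → N < Y.card → ∃ x ∈ Y, ∃ y ∈ Y, x ≠ y ∧ R x y) :
    ∃ Y : Finset α, Y.card ≤ N ∧ (∀ y ∈ Y, P y) ∧ ∀ x, P x → x ∈ Y ∨ ∃ y ∈ Y, R x y := by
  classical
  by_contra! hcon
  have key : ∀ n ≤ N + 1, ∃ Y : Finset α, Y.card = n ∧ (∀ y ∈ Y, P y) ∧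
      ∀ x ∈ Y, ∀ y ∈ Y, x ≠ y → ¬ R x y := by
    intro n
    induction n with
    | zero => exact fun _ => ⟨∅, by simp⟩
    | succ n ih =>
      intro hn
      obtain ⟨Y, h1, h2, h3⟩ := ih (by omega)
      obtain ⟨x, hx, hxY, hxR⟩ := hcon Y (by omega) h2
      refine ⟨insert x Y, by rw [Finset.card_insert_of_notMem hxY, h1], ?_, ?_⟩
      · intro y hy
        rcases Finset.mem_insert.1 hy with rfl | hy
        exacts [hx, h2 y hy]
      · intro a ha b hb hab
        rcases Finset.mem_insert.1 ha with rfl | ha' <;>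
          rcases Finset.mem_insert.1 hb with rfl | hb'
        · exact absurd rfl hab
        · exact hxR b hb'
        · exact fun h => hxR a ha' (hsymm _ _ h)
        · exact h3 a ha' b hb' hab
  obtain ⟨Y, h1, h2, h3⟩ := key (N + 1) le_rfl
  obtain ⟨x, hx, y, hy, hne, hR⟩ := h Y h2 (by omega)
  exact h3 x hx y hy hne hR

/-- The character `(-1)^z` of `𝔽₂`. -/
def sgn (z : ZMod 2) : ℝ := if z = 0 then 1 else -1

theorem eq_zero_or_one (z : ZMod 2) : z = 0 ∨ z = 1 := by revert z; decide

theorem sgn_zero : sgn 0 = 1 := if_pos rfl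

theorem sgn_one : sgn 1 = -1 := if_neg (by decide)

theorem sgn_add (a b : ZMod 2) : sgn (a + b) = sgn a * sgn b := by
  rcases eq_zero_or_one a with rfl | rfl <;> rcases eq_zero_or_one b with rfl | rfl
  · simp [sgn_zero]
  · simp [sgn_zero]
  · simp [sgn_zero]
  · rw [zmod_two_add_self, sgn_zero, sgn_one]; norm_num

theorem sgn_le_one (a : ZMod 2) : sgn a ≤ 1 := by
  rcases eq_zero_or_one a with rfl | rfl <;> simp [sgn_zero, sgn_one]

section Cover

variable {ι : Type} [Fintype ι] [DecidableEq ι]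

open Classical in
/-- On each line in direction `t` a form in `T ∋ t` vanishes or is balanced. -/
theorem sum_sgn_le {V : ι → Type} [∀ i, AddCommGroup (V i)] [∀ i, Module (ZMod 2) (V i)]
    [∀ i, Fintype (V i)] {T : Finset ι} {t : ι} (ht : t ∈ T) {f : (∀ i, V i) → ZMod 2}
    (hf : f ∈ MLin V T) :
    ∑ x, sgn (f x) ≤
      ((Finset.univ.filter fun x => ∀ v, f (Function.update x t v) = 0).card : ℝ) := by
  rw [← Finset.sum_filter_add_sum_filter_not Finset.univ
    (fun x => ∀ v, f (Function.update x t v) = 0)]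
  have h1 : ∑ x with ¬ ∀ v, f (Function.update x t v) = 0, sgn (f x) = 0 := by
    have h0 : ∀ z : ∀ i, V i, ∃ v, (¬ ∀ v, f (Function.update z t v) = 0) →
        f (Function.update z t v) = 1 := fun z => by
      by_cases h : ∀ v, f (Function.update z t v) = 0
      · exact ⟨0, fun h' => absurd h h'⟩
      · push Not at h
        obtain ⟨v, hv⟩ := h
        exact ⟨v, fun _ => (eq_zero_or_one _).resolve_left hv⟩
    choose s hs using h0
    have hs' : ∀ x : ∀ i, V i, (¬ ∀ v, f (Function.update x t v) = 0) →
        f (Function.update x t (s (Function.update x t 0))) = 1 := by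
      intro x hx
      have := hs (Function.update x t 0) (by simpa using hx)
      simpa using this
    have hflip : ∀ x : ∀ i, V i, (¬ ∀ v, f (Function.update x t v) = 0) →
        f (Function.update x t (x t + s (Function.update x t 0))) = f x + 1 := by
      intro x hx
      rw [MLin.update_add hf ht, hs' x hx, Function.update_eq_self]
    refine Finset.sum_involution
      (fun x _ => Function.update x t (x t + s (Function.update x t 0))) ?_ ?_ ?_ ?_
    · intro x hx
      rw [hflip x (Finset.mem_filter.1 hx).2, sgn_add, sgn_one]
      ring
    · intro x hx _ he
      have := hflip x (Finset.mem_filter.1 hx).2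
      rw [he] at this
      simp at this
    · intro x hx
      simpa using hx
    · intro x hx
      have h2 : s (Function.update x t 0) + s (Function.update x t 0) = 0 := by
        rw [← two_smul (ZMod 2) (s _), show (2 : ZMod 2) = 0 from rfl, zero_smul]
      simp [add_assoc, h2]
  rw [h1, add_zero]
  refine (Finset.sum_le_sum fun x _ => sgn_le_one (f x)).trans (le_of_eq ?_)
  simp

/-- The forms that vanish on three quarters of a dense set lie in boundedly many translates of the
set of forms of bounded partition rank: by Cauchy-Schwarz, among many of them some two have a
biased sum. -/
theorem Captures.exists_cover {T : Finset ι} {t : ι} (ht : t ∈ T)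
    (h : Captures (T.erase t)) (δ : ℝ) (hδ : 0 < δ) : ∃ N l : ℕ,
    ∀ (V : ι → Type) [∀ i, AddCommGroup (V i)] [∀ i, Module (ZMod 2) (V i)] [∀ i, Fintype (V i)]
      (B : Finset (∀ i, V i)), δ * Fintype.card (∀ i, V i) ≤ B.card →
      ∃ Y : Finset ((∀ i, V i) → ZMod 2), Y.card ≤ N ∧ (∀ y ∈ Y, y ∈ MLin V T) ∧
        ∀ f ∈ MLin V T, 4 * (B.filter fun b => f b ≠ 0).card ≤ B.card →
          ∃ y ∈ Y, LowRank (properParts T t) T l (f + y) := by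
  classical
  obtain ⟨l, hl⟩ := h.lowRank_of_biased ht (δ / 8) (by positivity)
  refine ⟨⌈8 / δ⌉₊, l, ?_⟩
  intro V _ _ _ B hB
  have hX : (0 : ℝ) < Fintype.card (∀ i, V i) := by exact_mod_cast Fintype.card_pos
  have hBpos : (0 : ℝ) < B.card := lt_of_lt_of_le (by positivity) hB
  have hself : ∀ f : (∀ i, V i) → ZMod 2, f + f = 0 := fun f => funext fun x =>
    zmod_two_add_self (f x)
  obtain ⟨Y, h1, h2, h3⟩ := exists_net
    (fun f : (∀ i, V i) → ZMod 2 => f ∈ MLin V T ∧ 4 * (B.filter fun b => f b ≠ 0).card ≤ B.card)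
    (fun f g => LowRank (properParts T t) T l (f + g)) (fun f g h => by rwa [add_comm])
    ⌈8 / δ⌉₊ (by
      intro Y hY hcard
      by_contra! hcon
      have hcard' : 8 / δ < Y.card := lt_of_le_of_lt (Nat.le_ceil _) (by exact_mod_cast hcard)
      -- each form of `Y` has correlation at least `1 / 2` with `B`
      have hlow : ∀ f ∈ Y, (B.card : ℝ) / 2 ≤ ∑ b ∈ B, sgn (f b) := by
        intro f hf
        have h4 := (hY f hf).2
        have h5 := Finset.card_filter_add_card_filter_not (s := B) (fun b => f b ≠ 0)
        have h6 : ∑ b ∈ B, sgn (f b) =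
            ((B.filter fun b => ¬ f b ≠ 0).card : ℝ) - (B.filter fun b => f b ≠ 0).card := by
          rw [← Finset.sum_filter_add_sum_filter_not B (fun b => f b ≠ 0),
            Finset.sum_congr (g := fun _ => (-1 : ℝ)) rfl fun b hb => by
              rw [sgn, if_neg (Finset.mem_filter.1 hb).2],
            Finset.sum_congr (s₁ := B.filter fun b => ¬ f b ≠ 0) (g := fun _ => (1 : ℝ)) rfl
              fun b hb => by rw [sgn, if_pos (not_not.1 (Finset.mem_filter.1 hb).2)]]
          simp only [Finset.sum_const, nsmul_eq_mul]
          ring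
        rw [h6]
        have h4' : (4 : ℝ) * (B.filter fun b => f b ≠ 0).card ≤ B.card := by exact_mod_cast h4
        have h5' : ((B.filter fun b => f b ≠ 0).card : ℝ) + (B.filter fun b => ¬ f b ≠ 0).card =
          B.card := by exact_mod_cast h5
        linarith
      have hcs : (Y.card * (B.card / 2) : ℝ) ^ 2 ≤
          B.card * ∑ x, (∑ f ∈ Y, sgn (f x)) ^ 2 := by
        calc (Y.card * (B.card / 2) : ℝ) ^ 2 ≤ (∑ b ∈ B, ∑ f ∈ Y, sgn (f b)) ^ 2 := by
              refine pow_le_pow_left₀ (by positivity) ?_ 2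
              rw [Finset.sum_comm, ← nsmul_eq_mul]
              exact Finset.card_nsmul_le_sum _ _ _ hlow
          _ ≤ B.card * ∑ b ∈ B, (∑ f ∈ Y, sgn (f b)) ^ 2 := sq_sum_le_card_mul_sum_sq
          _ ≤ _ := by
              refine mul_le_mul_of_nonneg_left ?_ hBpos.le
              exact Finset.sum_le_sum_of_subset_of_nonneg (Finset.subset_univ _)
                fun _ _ _ => sq_nonneg _
      have hexp : ∑ x, (∑ f ∈ Y, sgn (f x)) ^ 2 = ∑ f ∈ Y, ∑ g ∈ Y, ∑ x, sgn ((f + g) x) := by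
        simp only [sq, Finset.sum_mul_sum, Pi.add_apply, sgn_add]
        rw [Finset.sum_comm]
        exact Finset.sum_congr rfl fun f _ => Finset.sum_comm
      have hpair : ∀ f ∈ Y, ∀ g ∈ Y, ∑ x, sgn ((f + g) x) ≤
          (if f = g then (Fintype.card (∀ i, V i) : ℝ) else 0) +
            δ / 8 * Fintype.card (∀ i, V i) := by
        intro f hf g hg
        by_cases hfg : f = g
        · subst hfg
          rw [if_pos rfl, hself]
          simp only [Pi.zero_apply, sgn_zero, Finset.sum_const, nsmul_eq_mul, Finset.card_univ,
            mul_one]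
          linarith [mul_pos (half_pos hδ) hX]
        · rw [if_neg hfg, zero_add]
          by_contra! hbig
          have hmem := add_mem (hY f hf).1 (hY g hg).1
          refine hcon f hf g hg hfg (hl V (f + g) _ hmem (hbig.le.trans (sum_sgn_le ht hmem)) ?_)
          intro b hb
          exact (Finset.mem_filter.1 hb).2
      have hsum : ∑ f ∈ Y, ∑ g ∈ Y, ∑ x, sgn ((f + g) x) ≤
          Y.card * Fintype.card (∀ i, V i) +
            Y.card ^ 2 * (δ / 8 * Fintype.card (∀ i, V i)) := by
        refine (Finset.sum_le_sum fun f hf => Finset.sum_le_sum fun g hg =>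
          hpair f hf g hg).trans (le_of_eq ?_)
        simp only [Finset.sum_add_distrib, Finset.sum_ite_eq, Finset.sum_const, nsmul_eq_mul]
        rw [Finset.sum_congr (g := fun _ => (Fintype.card (∀ i, V i) : ℝ)) rfl
          fun f hf => if_pos hf]
        simp only [Finset.sum_const, nsmul_eq_mul]
        ring
      rw [hexp] at hcs
      have hYpos : (0 : ℝ) < Y.card := lt_trans (by positivity) hcard'
      have h7 : 8 < Y.card * δ := by rwa [div_lt_iff₀ hδ] at hcard'
      have h8 := hcs.trans (mul_le_mul_of_nonneg_left hsum hBpos.le)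
      have h9 : (Y.card : ℝ) * B.card / 4 ≤
          Fintype.card (∀ i, V i) + Y.card * (δ / 8 * Fintype.card (∀ i, V i)) := by
        have : (Y.card * B.card : ℝ) * (Y.card * B.card / 4) ≤ (Y.card * B.card : ℝ) *
            (Fintype.card (∀ i, V i) + Y.card * (δ / 8 * Fintype.card (∀ i, V i))) := by
          linarith
        exact le_of_mul_le_mul_left this (by positivity)
      have h10 : Y.card * (δ * Fintype.card (∀ i, V i)) / 4 ≤ (Y.card : ℝ) * B.card / 4 := by
        gcongr
      have h11 := mul_lt_mul_of_pos_right h7 hX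
      linarith)
  refine ⟨Y, h1, fun y hy => (h2 y hy).1, fun f hf hfB => ?_⟩
  rcases h3 f ⟨hf, hfB⟩ with hfY | h
  · refine ⟨f, hfY, ?_⟩
    rw [hself]
    exact .zero _
  · exact h

end Cover

/-! ### Eliminating one type of products -/

section Eliminate

variable {ι : Type} [Fintype ι] [DecidableEq ι]

/-- It suffices to write the forms as sums of a form in a fixed structured space and one of low
partition rank: after passing to a dense set on which the structured forms vanish, the low rank
parts almost vanish as well. -/
theorem CapturesLow.modulo {𝒥 : Finset (Finset ι)} {T : Finset ι} (h : CapturesLow 𝒥 T)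
    (h𝒥 : ∀ J ∈ 𝒥, J ⊆ T) (η : ℝ) (hη : 0 < η) :
    ∃ ε : ℝ, 0 < ε ∧ ∀ δ : ℝ, 0 < δ → ∀ m l : ℕ, ∃ k : ℕ,
    ∀ (V : ι → Type) [∀ i, AddCommGroup (V i)] [∀ i, Module (ZMod 2) (V i)] [∀ i, Fintype (V i)]
      (Ω : Type) [Fintype Ω] (w : Ω → ℝ) (r : Ω → (∀ i, V i) → ZMod 2) (B : Finset (∀ i, V i))
      (ε' : ℝ) (𝒮 : Finset (Finset ι × ((∀ i, V i) → ZMod 2))), ε' ≤ ε →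
      AlmostVanishing T δ ε' w r B → 𝒮.card ≤ m → Admissible T 𝒮 →
      mass w (fun ω => ¬ ∃ g, LowRank 𝒥 T l g ∧ r ω + g ∈ tspan T 𝒮) ≤ η / 2 →
      ∃ 𝒯 : Finset (Finset ι × ((∀ i, V i) → ZMod 2)), 𝒯.card ≤ k ∧ Admissible T 𝒯 ∧
        mass w (fun ω => r ω ∉ tspan T 𝒯) ≤ η := by
  classical
  obtain ⟨ε, hε, H⟩ := h (η / 2) (by positivity)
  refine ⟨ε / 2 ^ T.card, by positivity, fun δ hδ m l => ?_⟩
  obtain ⟨k, H⟩ := H (δ / 2 ^ m) (by positivity) l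
  refine ⟨m + k, ?_⟩
  intro V _ _ _ Ω _ w r B ε' 𝒮 hε' hB hm h𝒮 hmass
  obtain ⟨B', h1, h2, h3⟩ := exists_sums_vanishing B 𝒮 h𝒮 w r hB.nonneg hB.mem ε' hB.vanish
  have hg : ∀ ω, ∃ g, LowRank 𝒥 T l g ∧
      ((∃ g, LowRank 𝒥 T l g ∧ r ω + g ∈ tspan T 𝒮) → r ω + g ∈ tspan T 𝒮) ∧
      ∀ b ∈ B', g b ≠ 0 → r ω b ≠ 0 := by
    intro ω
    by_cases hω : ∃ g, LowRank 𝒥 T l g ∧ r ω + g ∈ tspan T 𝒮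
    · obtain ⟨g, hg, hgS⟩ := hω
      refine ⟨g, hg, fun _ => hgS, fun b hb hgb hrb => hgb ?_⟩
      have := tspan_apply_eq_zero hgS b (h2 b hb)
      simpa [hrb] using this
    · exact ⟨0, .zero _, fun h' => absurd h' hω, fun b _ h0 => absurd rfl h0⟩
  choose g hg1 hg2 hg3 using hg
  obtain ⟨𝒯, h4, h5, h6⟩ := H V Ω w g B'
    { nonneg := hB.nonneg
      sum_le_one := hB.sum_le_one
      mem := fun ω => (hg1 ω).mem_MLin h𝒥
      dense := by
        have e1 : (B.card : ℝ) ≤ 2 ^ 𝒮.card * B'.card := by exact_mod_cast h1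
        have e2 : (2 : ℝ) ^ 𝒮.card ≤ 2 ^ m := pow_le_pow_right₀ one_le_two hm
        have e3 := hB.dense
        rw [div_mul_eq_mul_div, div_le_iff₀ (by positivity)]
        calc _ ≤ (B.card : ℝ) := e3
          _ ≤ 2 ^ 𝒮.card * B'.card := e1
          _ ≤ 2 ^ m * B'.card := by gcongr
          _ = _ := mul_comm _ _
      vanish := by
        intro b hb
        refine (mass_mono hB.nonneg fun ω hω => hg3 ω b hb hω).trans ((h3 b hb).trans ?_)
        rw [le_div_iff₀ (by positivity)] at hε'
        linarith } hg1
  refine ⟨𝒮 ∪ 𝒯, (Finset.card_union_le _ _).trans (by omega), h𝒮.union h5, ?_⟩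
  have : mass w (fun ω => r ω ∉ tspan T (𝒮 ∪ 𝒯)) ≤
      mass w (fun ω => ¬ ∃ g, LowRank 𝒥 T l g ∧ r ω + g ∈ tspan T 𝒮) +
      mass w (fun ω => g ω ∉ tspan T 𝒯) := by
    refine mass_le_add hB.nonneg fun ω hω => ?_
    by_contra! hcon
    refine hω ?_
    have := sub_mem (tspan_mono Finset.subset_union_left (hg2 ω hcon.1))
      (tspan_mono Finset.subset_union_right hcon.2)
    rwa [add_sub_cancel_right] at this
  linarith

/-- Vectors split into a combination of vectors of `Z` and a part that vanishes for the vectors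
of `Z`, linearly. -/
theorem exists_linear_splitting {l : ℕ} (Z : Finset (Fin l → ZMod 2)) :
    ∃ (p : (Fin l → ZMod 2) →ₗ[ZMod 2] (Fin l → ZMod 2))
      (M : (Fin l → ZMod 2) →ₗ[ZMod 2] (Z → ZMod 2)),
      (∀ a, a = p a + ∑ z : Z, M a z • z.1) ∧ ∀ z ∈ Z, p z = 0 := by
  let L := Fintype.linearCombination (ZMod 2) (fun z : Z => z.1)
  obtain ⟨q, hq⟩ := LinearMap.exists_leftInverse_of_injective (LinearMap.range L).subtype
    (Submodule.ker_subtype _)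
  obtain ⟨M, hM⟩ := Module.projective_lifting_property L.rangeRestrict q
    (LinearMap.surjective_rangeRestrict L)
  have hM' : ∀ a, L (M a) = q a := fun a => congrArg Subtype.val (LinearMap.congr_fun hM a)
  refine ⟨LinearMap.id - (LinearMap.range L).subtype ∘ₗ q, M, fun a => ?_, fun z hz => ?_⟩
  · have := hM' a
    simp only [L, Fintype.linearCombination_apply] at this
    rw [this]
    simp
  · have hz' : z ∈ LinearMap.range L := by
      classical
      refine ⟨Pi.single ⟨z, hz⟩ 1, ?_⟩
      simp [L, Fintype.linearCombination_apply_single]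
    have := LinearMap.congr_fun hq ⟨z, hz'⟩
    simp only [LinearMap.comp_apply, Submodule.subtype_apply, LinearMap.id_apply] at this
    simp [this]

variable {V : ι → Type} [∀ i, AddCommGroup (V i)]

omit [Fintype ι] in
theorem MLin.linear_comp {I : Finset ι} {l : ℕ} {φ : Fin l → (∀ i, V i) → ZMod 2}
    (hφ : ∀ j, φ j ∈ MLin V I) (L : (Fin l → ZMod 2) →ₗ[ZMod 2] ZMod 2) :
    (fun x => L fun j => φ j x) ∈ MLin V I := by
  refine ⟨fun i hi x a b => ?_, fun i hi x a => ?_⟩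
  · rw [← map_add]
    exact congrArg L (funext fun j => MLin.update_add (hφ j) hi x a b)
  · exact congrArg L (funext fun j => MLin.update_of_notMem (hφ j) hi x a)

omit [Fintype ι] in
open Classical in
/-- Suppose that for `a ∈ Z` the form `∑ a_j ψ_j` is of low rank modulo a finite set `Y`. Then
the part of `∑ φ_j ψ_j` in which `φ` takes values in the span of `Z` is a structured form plus
products of other types, and the remaining part is structured as soon as the forms `ρ_j`,
which vanish wherever `φ` takes values in `Z`, are. -/
theorem exists_decomposition {T J : Finset ι} {t : ι} {𝒥 : Finset (Finset ι)} (hJ : J ⊆ T)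
    (h𝒥 : ∀ K ∈ properParts (T \ J) t, J ∪ K ∈ 𝒥) {l m : ℕ}
    {φ ψ : Fin l → (∀ i, V i) → ZMod 2} (hφ : ∀ j, φ j ∈ MLin V J)
    (hψ : ∀ j, ψ j ∈ MLin V (T \ J)) (Y : Finset ((∀ i, V i) → ZMod 2))
    (Z : Finset (Fin l → ZMod 2))
    (hZ : ∀ a ∈ Z, ∃ y ∈ Y, LowRank (properParts (T \ J) t) (T \ J) m (∑ j, a j • ψ j + y)) :
    ∃ ρ : Fin l → (∀ i, V i) → ZMod 2, (∀ j, ρ j ∈ MLin V J) ∧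
      (∀ b, (fun j => φ j b) ∈ Z → ∀ j, ρ j b = 0) ∧
      ∀ 𝒮 : Finset (Finset ι × ((∀ i, V i) → ZMod 2)), Admissible J 𝒮 →
        (∀ j, ρ j ∈ tspan J 𝒮) → ∃ g, LowRank 𝒥 T (2 ^ l * m) g ∧
          ∑ j, φ j * ψ j + g ∈ tspan T (𝒮 ∪ Y.image fun y => (T \ J, y)) := by
  obtain ⟨p, M, hpM, hp⟩ := exists_linear_splitting Z
  choose! y hyY hy using hZ
  refine ⟨fun j x => p (fun i => φ i x) j,
    fun j => MLin.linear_comp hφ (LinearMap.proj j ∘ₗ p), fun b hb j => ?_, ?_⟩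
  · simp [hp _ hb]
  intro 𝒮 h𝒮 hρ
  let μ : Z → (∀ i, V i) → ZMod 2 := fun z x => M (fun i => φ i x) z
  have hμ : ∀ z, μ z ∈ MLin V J := fun z => MLin.linear_comp hφ (LinearMap.proj z ∘ₗ M)
  refine ⟨∑ z : Z, μ z * (∑ j, z.1 j • ψ j + y z.1), ?_, ?_⟩
  · refine (LowRank.sum Finset.univ _ fun z _ => (hy z.1 z.2).mul (hμ z) h𝒥).mono ?_
    refine Nat.mul_le_mul_right _ ?_
    have := Finset.card_le_univ Z
    simpa using this
  · have e : ∑ j, φ j * ψ j + ∑ z : Z, μ z * (∑ j, z.1 j • ψ j + y z.1) =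
        ∑ j, (fun x => p (fun i => φ i x) j) * ψ j + ∑ z : Z, y z.1 * μ z := by
      have e1 : ∑ j, φ j * ψ j = ∑ j, (fun x => p (fun i => φ i x) j) * ψ j +
          ∑ z : Z, μ z * ∑ j, z.1 j • ψ j := by
        ext x
        have hx := hpM fun i => φ i x
        simp only [Finset.sum_apply, Pi.mul_apply, Pi.add_apply, Pi.smul_apply, smul_eq_mul]
        have hx' : ∀ j, φ j x = p (fun i => φ i x) j + ∑ z : Z, μ z x * z.1 j := fun j => by
          simpa using congrFun hx j
        simp only [Finset.mul_sum]
        rw [Finset.sum_comm, ← Finset.sum_add_distrib]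
        refine Finset.sum_congr rfl fun j _ => ?_
        conv_lhs => rw [hx' j]
        rw [add_mul, Finset.sum_mul]
        simp only [mul_assoc]
      rw [e1]
      simp only [mul_add, Finset.sum_add_distrib]
      have h2 : ∑ z : Z, μ z * ∑ j, z.1 j • ψ j + ∑ z : Z, μ z * ∑ j, z.1 j • ψ j = 0 :=
        funext fun x => zmod_two_add_self _
      rw [add_assoc, ← add_assoc (∑ z : Z, μ z * ∑ j, z.1 j • ψ j), h2, zero_add]
      simp only [mul_comm (y _)]
    rw [e]
    refine add_mem (Submodule.sum_mem _ fun j _ => ?_) (Submodule.sum_mem _ fun z _ => ?_)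
    · exact tspan_mono Finset.subset_union_left (tspan_mul hJ h𝒮 (hρ j) (hψ j))
    · refine tspan_mono Finset.subset_union_right ?_
      refine mul_mem_tspan (s := (T \ J, y z.1)) (Finset.mem_image_of_mem _ (hyY _ z.2)) ?_
      simpa [Finset.inter_eq_right.2 hJ] using hμ z

/-! ### Counting -/

omit [∀ i, AddCommGroup (V i)] in
open Classical in
theorem sum_card_piecewise [∀ i, Fintype (V i)] (J : Finset ι) (B : Finset (∀ i, V i)) :
    ∑ b : ∀ i, V i, (Finset.univ.filter fun c => J.piecewise b c ∈ B).card =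
      Fintype.card (∀ i, V i) * B.card := by
  let e : ((∀ i, V i) × (∀ i, V i)) ≃ ((∀ i, V i) × (∀ i, V i)) :=
    Function.Involutive.toPerm (fun q => (J.piecewise q.1 q.2, J.piecewise q.2 q.1)) (by
      rintro ⟨x, y⟩
      ext i <;> by_cases hi : i ∈ J <;> simp [hi])
  have h1 : ∑ b : ∀ i, V i, (Finset.univ.filter fun c => J.piecewise b c ∈ B).card =
      ∑ q : (∀ i, V i) × (∀ i, V i), if (e q).1 ∈ B then 1 else 0 := by
    rw [Fintype.sum_prod_type]
    simp only [Finset.card_filter]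
    rfl
  rw [h1, Equiv.sum_comp e fun q => if q.1 ∈ B then 1 else 0, Fintype.sum_prod_type]
  rw [Finset.sum_comm]
  simp

open Classical in
/-- For a positive proportion of the points `b` the fibre of a dense set over the `J`-coordinates
of `b` is dense. -/
theorem exists_dense_fibres [∀ i, Fintype (V i)] (J : Finset ι) (B : Finset (∀ i, V i)) (δ : ℝ)
    (hB : δ * Fintype.card (∀ i, V i) ≤ B.card) :
    δ / 2 * Fintype.card (∀ i, V i) ≤ ((Finset.univ.filter fun b : ∀ i, V i =>
      δ / 2 * Fintype.card (∀ i, V i) ≤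
        ((Finset.univ.filter fun c => J.piecewise b c ∈ B).card : ℝ)).card : ℝ) := by
  set X := (Fintype.card (∀ i, V i) : ℝ) with hXdef
  have hX : 0 < X := by rw [hXdef]; exact_mod_cast Fintype.card_pos
  have h1 : ∑ b : ∀ i, V i, ((Finset.univ.filter fun c => J.piecewise b c ∈ B).card : ℝ) =
      X * B.card := by
    rw [hXdef]
    exact_mod_cast sum_card_piecewise J B
  set S := Finset.univ.filter fun b : ∀ i, V i => δ / 2 * X ≤
        ((Finset.univ.filter fun c => J.piecewise b c ∈ B).card : ℝ) with hS
  by_cases hδ : δ ≤ 0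
  · exact (mul_nonpos_of_nonpos_of_nonneg (by linarith) hX.le).trans (Nat.cast_nonneg _)
  push Not at hδ
  have h2 : ∀ b : ∀ i, V i, ((Finset.univ.filter fun c => J.piecewise b c ∈ B).card : ℝ) ≤
      (if b ∈ S then X else 0) + δ / 2 * X := by
    intro b
    by_cases hb : b ∈ S
    · rw [if_pos hb]
      have : ((Finset.univ.filter fun c => J.piecewise b c ∈ B).card : ℝ) ≤ X := by
        rw [hXdef]; exact_mod_cast Finset.card_le_univ _
      have := mul_pos (half_pos hδ) hX
      linarith
    · rw [if_neg hb, zero_add]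
      simp only [hS, Finset.mem_filter, Finset.mem_univ, true_and, not_le] at hb
      exact hb.le
  have h3 := Finset.sum_le_sum fun b (_ : b ∈ (Finset.univ : Finset (∀ i, V i))) => h2 b
  rw [h1, Finset.sum_add_distrib] at h3
  simp only [Finset.sum_ite_mem, Finset.univ_inter, Finset.sum_const, nsmul_eq_mul,
    Finset.card_univ] at h3
  rw [← hXdef] at h3
  have h4 : X * (δ * X) ≤ X * B.card := mul_le_mul_of_nonneg_left hB hX.le
  have h5 : X * (δ / 2 * X) ≤ X * (S.card : ℝ) := by linarith
  exact le_of_mul_le_mul_left h5 hX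

open Classical in
/-- Objects that for a proportion `c` of the `b ∈ S` are near to one of `N` centres `C b` lie in
boundedly many classes of the relation "near to a common centre". -/
theorem exists_net_of_centres {X α : Type} (S : Finset X) (hS : S.Nonempty) (P : α → Prop)
    (C : X → Finset α) (near R : α → α → Prop) (hsymm : ∀ x y, R x y → R y x)
    (hR : ∀ x x' y, near x y → near x' y → R x x')
    (N : ℕ) (hN : ∀ b ∈ S, (C b).card ≤ N) (c : ℝ) (hc : 0 < c) :
    ∃ Z : Finset α, Z.card ≤ ⌈N / c⌉₊ ∧ (∀ z ∈ Z, P z) ∧ ∀ x, P x →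
      c * S.card ≤ ((S.filter fun b => ∃ y ∈ C b, near x y).card : ℝ) →
      x ∈ Z ∨ ∃ z ∈ Z, R x z := by
  obtain ⟨Z, h1, h2, h3⟩ := exists_net
    (fun x => P x ∧ c * S.card ≤ ((S.filter fun b => ∃ y ∈ C b, near x y).card : ℝ)) R hsymm
    ⌈N / c⌉₊ (by
      intro Z hZ hcard
      by_contra! hcon
      have h4 : ∀ b ∈ S, (Z.filter fun x => ∃ y ∈ C b, near x y).card ≤ N := by
        intro b hb
        refine le_trans ?_ (hN b hb)
        have hch : ∀ x ∈ Z.filter fun x => ∃ y ∈ C b, near x y, ∃ y ∈ C b, near x y :=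
          fun x hx => (Finset.mem_filter.1 hx).2
        choose! f hf1 hf2 using hch
        refine Finset.card_le_card_of_injOn f hf1 fun x hx x' hx' he => ?_
        by_contra hne
        refine hcon x (Finset.mem_filter.1 hx).1 x' (Finset.mem_filter.1 hx').1 hne ?_
        refine hR x x' (f x) (hf2 x hx) ?_
        rw [he]
        exact hf2 x' hx'
      have h5 : ∑ x ∈ Z, (S.filter fun b => ∃ y ∈ C b, near x y).card =
          ∑ b ∈ S, (Z.filter fun x => ∃ y ∈ C b, near x y).card := by
        simp only [Finset.card_filter]
        exact Finset.sum_comm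
      have h6 : (Z.card : ℝ) * (c * S.card) ≤ S.card * N := by
        calc (Z.card : ℝ) * (c * S.card)
            ≤ ∑ x ∈ Z, ((S.filter fun b => ∃ y ∈ C b, near x y).card : ℝ) := by
              rw [← nsmul_eq_mul]
              exact Finset.card_nsmul_le_sum _ _ _ fun x hx => (hZ x hx).2
          _ = ((∑ b ∈ S, (Z.filter fun x => ∃ y ∈ C b, near x y).card : ℕ) : ℝ) := by
              rw [← h5]; push_cast; rfl
          _ ≤ S.card * N := by
              have := Finset.sum_le_card_nsmul _ _ _ h4
              rw [smul_eq_mul] at this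
              exact_mod_cast this
      have hSpos : (0 : ℝ) < S.card := by exact_mod_cast hS.card_pos
      have h7 : N / c < Z.card := lt_of_le_of_lt (Nat.le_ceil _) (by exact_mod_cast hcard)
      rw [div_lt_iff₀ hc] at h7
      have h8 := mul_lt_mul_of_pos_right h7 hSpos
      linarith)
  exact ⟨Z, h1, fun z hz => (h2 z hz).1, fun x hx hx' => h3 x ⟨hx, hx'⟩⟩

end Eliminate

/-! ### The induction -/

theorem mass_one_subtype {X : Type} (S : Finset X) (P : X → Prop) [DecidablePred P] :
    mass (fun _ : S => (1 : ℝ)) (fun s => P s) = (S.filter P).card := by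
  classical
  rw [mass_eq_sum_ite, Finset.card_filter, ← Finset.sum_coe_sort S fun s => if P s then 1 else 0]
  push_cast
  exact Finset.sum_congr rfl fun s _ => by congr

section Induction

variable {ι : Type} [Fintype ι] [DecidableEq ι]

omit [Fintype ι] [DecidableEq ι] in
/-- At each point where the family almost vanishes on a large fibre, the family obtained by
fixing the `J`-coordinates of the point mostly vanishes on three quarters of the fibre. -/
theorem mass_contract_le {V : ι → Type} [∀ i, AddCommGroup (V i)] [∀ i, Fintype (V i)]
    {Ω : Type} [Fintype Ω] {w : Ω → ℝ} (hw : ∀ ω, 0 ≤ w ω) {r : Ω → (∀ i, V i) → ZMod 2}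
    {C : Finset (∀ i, V i)} (hC : C.Nonempty) {ε : ℝ}
    (h : ∀ c ∈ C, mass w (fun ω => r ω c ≠ 0) ≤ ε) :
    mass w (fun ω => ¬ 4 * (C.filter fun c => r ω c ≠ 0).card ≤ C.card) ≤ 4 * ε := by
  have hpos : (0 : ℝ) < C.card := by exact_mod_cast hC.card_pos
  have := mass_markov C (fun ω c => r ω c ≠ 0) hw ε (1 / 4) h
    (fun ω => ¬ 4 * (C.filter fun c => r ω c ≠ 0).card ≤ C.card) (fun ω hω => by
      rw [mass_one_subtype C fun c => r ω c ≠ 0]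
      have : (C.card : ℝ) < 4 * (C.filter fun c => r ω c ≠ 0).card := by
        exact_mod_cast not_le.1 hω
      linarith)
  have h2 : (C.card : ℝ) * mass w (fun ω => ¬ 4 * (C.filter fun c => r ω c ≠ 0).card ≤ C.card) ≤
      C.card * (4 * ε) := by linarith
  exact le_of_mul_le_mul_left h2 hpos

open Classical in
/-- If for each `b ∈ S` all but weight `4 ε` of the vectors `Φ ω b` have the property `E b ω`, and
a vector is heavy when it has this property for many `b`, then for half of the `b ∈ S` all but
weight `10 ε` of the vectors `Φ ω b` are heavy. -/
theorem exists_mostly_heavy {X Ω A : Type} [Fintype Ω] [Fintype A] {w : Ω → ℝ}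
    (hw : ∀ ω, 0 ≤ w ω) (hw1 : ∑ ω, w ω ≤ 1) (S : Finset X) (Φ : Ω → X → A)
    (E : X → Ω → A → Prop) (ε c : ℝ) (hε : 0 < ε) (hc0 : 0 ≤ c)
    (hc : Fintype.card A * c ≤ ε)
    (hE : ∀ b ∈ S, mass w (fun ω => ¬ E b ω (Φ ω b)) ≤ 4 * ε) (heavy : Ω → A → Prop)
    (hheavy : ∀ ω a, ¬ heavy ω a → ((S.filter fun b => E b ω a).card : ℝ) ≤ c * S.card) :
    (S.card : ℝ) / 2 ≤
      ((S.filter fun b => mass w (fun ω => ¬ heavy ω (Φ ω b)) ≤ 10 * ε).card : ℝ) := by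
  have h1 : ∑ b ∈ S, mass w (fun ω => E b ω (Φ ω b) ∧ ¬ heavy ω (Φ ω b)) ≤ ε * S.card := by
    calc ∑ b ∈ S, mass w (fun ω => E b ω (Φ ω b) ∧ ¬ heavy ω (Φ ω b))
        = ∑ ω, w ω * ((S.filter fun b => E b ω (Φ ω b) ∧ ¬ heavy ω (Φ ω b)).card : ℝ) := by
          simp only [mass_eq_sum_ite]
          rw [Finset.sum_comm]
          refine Finset.sum_congr rfl fun ω _ => ?_
          rw [Finset.card_filter]
          push_cast
          rw [Finset.mul_sum]
          refine Finset.sum_congr rfl fun b _ => ?_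
          by_cases hb : E b ω (Φ ω b) ∧ ¬ heavy ω (Φ ω b) <;> simp [hb]
      _ ≤ ∑ ω, w ω * (ε * S.card) := by
          refine Finset.sum_le_sum fun ω _ => mul_le_mul_of_nonneg_left ?_ (hw ω)
          have hsub : (S.filter fun b => E b ω (Φ ω b) ∧ ¬ heavy ω (Φ ω b)) ⊆
              (Finset.univ.filter fun a : A => ¬ heavy ω a).biUnion
                fun a => S.filter fun b => E b ω a := by
            intro b hb
            rw [Finset.mem_filter] at hb
            rw [Finset.mem_biUnion]
            exact ⟨Φ ω b, by simpa using hb.2.2, Finset.mem_filter.2 ⟨hb.1, hb.2.1⟩⟩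
          calc ((S.filter fun b => E b ω (Φ ω b) ∧ ¬ heavy ω (Φ ω b)).card : ℝ)
              ≤ ∑ a with ¬ heavy ω a, ((S.filter fun b => E b ω a).card : ℝ) := by
                exact_mod_cast (Finset.card_le_card hsub).trans Finset.card_biUnion_le
            _ ≤ ∑ a with ¬ heavy ω a, c * S.card :=
                Finset.sum_le_sum fun a ha => hheavy ω a (Finset.mem_filter.1 ha).2
            _ ≤ Fintype.card A * (c * S.card) := by
                rw [Finset.sum_const, nsmul_eq_mul]
                refine mul_le_mul_of_nonneg_right ?_ (by positivity)
                exact_mod_cast Finset.card_le_univ _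
            _ ≤ ε * S.card := by
                rw [← mul_assoc]
                exact mul_le_mul_of_nonneg_right hc (Nat.cast_nonneg _)
      _ ≤ ε * S.card := by
          rw [← Finset.sum_mul]
          exact mul_le_of_le_one_left (by positivity) hw1
  have h2 : ∑ b ∈ S, mass w (fun ω => ¬ heavy ω (Φ ω b)) ≤ 5 * ε * S.card := by
    calc ∑ b ∈ S, mass w (fun ω => ¬ heavy ω (Φ ω b))
        ≤ ∑ b ∈ S, (4 * ε + mass w (fun ω => E b ω (Φ ω b) ∧ ¬ heavy ω (Φ ω b))) := by
          refine Finset.sum_le_sum fun b hb => ?_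
          refine (mass_le_add hw fun ω hω => ?_).trans (add_le_add_left (hE b hb) _)
          by_cases h : E b ω (Φ ω b)
          exacts [Or.inr ⟨h, hω⟩, Or.inl h]
      _ ≤ _ := by
          rw [Finset.sum_add_distrib, Finset.sum_const, nsmul_eq_mul]
          linarith
  have h3 : ((S.filter fun b => ¬ mass w (fun ω => ¬ heavy ω (Φ ω b)) ≤ 10 * ε).card : ℝ) *
      (10 * ε) ≤ 5 * ε * S.card := by
    refine le_trans ?_ h2
    rw [← nsmul_eq_mul]
    refine (Finset.card_nsmul_le_sum _ _ _ fun b hb =>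
      (not_le.1 (Finset.mem_filter.1 hb).2).le).trans ?_
    exact Finset.sum_le_sum_of_subset_of_nonneg (Finset.filter_subset _ _)
      fun _ _ _ => mass_nonneg hw
  have h4 : ((S.filter fun b => mass w (fun ω => ¬ heavy ω (Φ ω b)) ≤ 10 * ε).card : ℝ) +
      (S.filter fun b => ¬ mass w (fun ω => ¬ heavy ω (Φ ω b)) ≤ 10 * ε).card = S.card := by
    exact_mod_cast Finset.card_filter_add_card_filter_not _
  have h5 : ((S.filter fun b => ¬ mass w (fun ω => ¬ heavy ω (Φ ω b)) ≤ 10 * ε).card : ℝ) ≤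
      S.card / 2 := by
    have : ε * ((S.filter fun b => ¬ mass w (fun ω => ¬ heavy ω (Φ ω b)) ≤ 10 * ε).card : ℝ) ≤
      ε * (S.card / 2) := by linarith
    exact le_of_mul_le_mul_left this hε
  linarith

/-- The products of one type `J`, of minimal size among those occurring, can be eliminated.
Write the forms as `∑ φ_j ψ_j + g` with `φ_j` in `J`, `ψ_j` in `T \ J` and `g` of other types. For
most points `b`, fixing the `J`-coordinates gives `∑ φ_j(b) ψ_j` up to low rank, and this form is
biased, so it has low rank modulo boundedly many forms. Hence `φ` mostly takes values in the span
`W` of the `a` for which `∑ a_j ψ_j` is of low rank modulo a bounded set. The part of `φ`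
outside `W` mostly vanishes, so it is captured by induction, and the rest splits further. -/
theorem CapturesLow.of_erase {T : Finset ι} {t : ι} (ht : t ∈ T)
    (hT : ∀ U, U ⊂ T → Captures U) {𝒥 : Finset (Finset ι)} (h𝒥 : 𝒥 ⊆ properParts T t)
    (hup : ∀ J ∈ 𝒥, ∀ K ∈ properParts T t, J ⊆ K → K ∈ 𝒥) {J : Finset ι} (hJ : J ∈ 𝒥)
    (hmin : ∀ K ∈ 𝒥, K ⊆ J → K = J) (h : CapturesLow (𝒥.erase J) T) : CapturesLow 𝒥 T := by
  classical
  obtain ⟨hJne, hJT⟩ := mem_properParts.1 (h𝒥 hJ)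
  have htJ : t ∉ J := fun h => by simpa using hJT h
  have hJT' : J ⊆ T := hJT.trans (Finset.erase_subset _ _)
  have htTJ : t ∈ T \ J := Finset.mem_sdiff.2 ⟨ht, htJ⟩
  have h𝒥T : ∀ K ∈ 𝒥.erase J, K ⊆ T := fun K hK =>
    (mem_properParts.1 (h𝒥 (Finset.mem_of_mem_erase hK))).2.trans (Finset.erase_subset _ _)
  have hunion : ∀ K ∈ properParts (T \ J) t, J ∪ K ∈ 𝒥.erase J := by
    intro K hK
    obtain ⟨⟨i, hi⟩, hKT⟩ := mem_properParts.1 hK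
    have hi' := Finset.mem_sdiff.1 (Finset.mem_of_mem_erase (hKT hi))
    refine Finset.mem_erase.2 ⟨fun he => hi'.2 (he ▸ Finset.mem_union_right _ hi),
      hup J hJ _ (mem_properParts.2 ⟨hJne.mono Finset.subset_union_left,
        Finset.union_subset hJT (hKT.trans (Finset.erase_subset_erase _ Finset.sdiff_subset))⟩)
        Finset.subset_union_left⟩
  have hCJ : Captures J := hT J (Finset.ssubset_iff_subset_ne.2 ⟨hJT', fun he => htJ (he ▸ ht)⟩)
  have hCTJ : Captures ((T \ J).erase t) := hT _
    ((Finset.erase_ssubset htTJ).trans_subset Finset.sdiff_subset)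
  intro η hη
  obtain ⟨ε₁, hε₁, H₁⟩ := h.modulo h𝒥T η hη
  obtain ⟨ε₂, hε₂, H₂⟩ := hCJ.tuple (η / 2) (by positivity)
  refine ⟨min ε₁ (ε₂ / 10), by positivity, fun δ hδ l => ?_⟩
  set ε := min ε₁ (ε₂ / 10) with hεdef
  have hε : 0 < ε := by positivity
  obtain ⟨N, l₁, hcover⟩ := hCTJ.exists_cover htTJ (δ / 2) (by positivity)
  obtain ⟨k₁, H₂⟩ := H₂ (δ / 4) (by positivity)
  obtain ⟨k, H₁⟩ := H₁ δ hδ (k₁ + ⌈N / (ε / 2 ^ l)⌉₊)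
    (2 ^ l * ((l₁ + l) + (l₁ + l)) + l)
  refine ⟨k, ?_⟩
  intro V _ _ _ Ω _ w r B hB hr
  have hX : (0 : ℝ) < Fintype.card (∀ i, V i) := by exact_mod_cast Fintype.card_pos
  have hself : ∀ f : (∀ i, V i) → ZMod 2, f + f = 0 := fun f => funext fun x =>
    zmod_two_add_self (f x)
  choose φ ψ g hφ hψ hg hrφ using fun ω => (hr ω).split J
  let fib : (∀ i, V i) → Finset (∀ i, V i) := fun b =>
    Finset.univ.filter fun c => J.piecewise b c ∈ B
  let S : Finset (∀ i, V i) := Finset.univ.filter fun b =>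
    δ / 2 * Fintype.card (∀ i, V i) ≤ ((fib b).card : ℝ)
  have hScard : δ / 2 * Fintype.card (∀ i, V i) ≤ (S.card : ℝ) :=
    exists_dense_fibres J B δ hB.dense
  have hfib : ∀ b ∈ S, δ / 2 * Fintype.card (∀ i, V i) ≤ ((fib b).card : ℝ) := fun b hb =>
    (Finset.mem_filter.1 hb).2
  have hSne : S.Nonempty := by
    have : (0 : ℝ) < S.card := lt_of_lt_of_le (by positivity) hScard
    rw [← Finset.card_pos]
    exact_mod_cast this
  choose! C hC1 _ hC3 using fun b hb => hcover V (fib b) (hfib b hb)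
  let near : ((∀ i, V i) → ZMod 2) → ((∀ i, V i) → ZMod 2) → Prop := fun f y =>
    LowRank (properParts (T \ J) t) (T \ J) (l₁ + l) (f + y)
  let close : ((∀ i, V i) → ZMod 2) → ((∀ i, V i) → ZMod 2) → Prop := fun f f' =>
    LowRank (properParts (T \ J) t) (T \ J) ((l₁ + l) + (l₁ + l)) (f + f')
  let comb : Ω → (Fin l → ZMod 2) → (∀ i, V i) → ZMod 2 := fun ω a => ∑ j, a j • ψ ω j
  have hcomb : ∀ ω a, comb ω a ∈ MLin V (T \ J) := fun ω a =>
    Submodule.sum_mem _ fun j _ => Submodule.smul_mem _ _ (hψ ω j)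
  -- the values of `φ` at most points give combinations of the `ψ_j` near to one of the centres
  have hE : ∀ b ∈ S, mass w (fun ω => ¬ ∃ y ∈ C b, near (comb ω fun j => φ ω j b) y) ≤ 4 * ε := by
    intro b hb
    have hne : (fib b).Nonempty := by
      have : (0 : ℝ) < (fib b).card := lt_of_lt_of_le (by positivity) (hfib b hb)
      rw [← Finset.card_pos]
      exact_mod_cast this
    refine (mass_mono hB.nonneg fun ω hω hspec => hω ?_).trans
      (mass_contract_le (r := fun ω => contract J b (r ω)) (C := fib b) hB.nonneg hne
        fun c hc => hB.vanish _ (Finset.mem_filter.1 hc).2)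
    obtain ⟨y, hy, hlow⟩ := hC3 b hb _ (MLin.contract (hB.mem ω) J b) hspec
    refine ⟨y, hy, ?_⟩
    have hcon : contract J b (r ω) = comb ω (fun j => φ ω j b) + contract J b (g ω) := by
      ext c
      have := congrFun (hrφ ω) (J.piecewise b c)
      simp only [Pi.add_apply, Finset.sum_apply, Pi.mul_apply,
        MLin.piecewise_of_subset (hφ ω _) J subset_rfl,
        MLin.piecewise_of_disjoint (hψ ω _) J Finset.disjoint_sdiff] at this
      simpa [contract, comb] using this
    have hglow := (hg ω).contract (J := J) (t := t) (fun K hK =>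
      ⟨(mem_properParts.1 (h𝒥 (Finset.mem_of_mem_erase hK))).2,
        fun hKJ => (Finset.mem_erase.1 hK).1 (hmin K (Finset.mem_of_mem_erase hK) hKJ)⟩) b
    have := hlow.add_lowRank hglow
    rw [hcon, add_right_comm, add_assoc (comb _ _), hself, add_zero] at this
    exact this
  obtain ⟨Y, hY1, hY2, hY3⟩ := exists_net_of_centres S hSne (fun f => f ∈ MLin V (T \ J)) C near
    close (fun f f' hff' => by simpa only [close, add_comm] using hff')
    (fun f f' y hf hf' => by
      have := LowRank.add_lowRank hf hf'
      rwa [add_add_add_comm f y f' y, hself, add_zero] at this)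
    N hC1 (ε / 2 ^ l) (by positivity)
  let heavy : Ω → (Fin l → ZMod 2) → Prop := fun ω a =>
    ε / 2 ^ l * S.card ≤ ((S.filter fun b => ∃ y ∈ C b, near (comb ω a) y).card : ℝ)
  have hS' := exists_mostly_heavy hB.nonneg hB.sum_le_one S (fun ω b j => φ ω j b)
    (fun b ω a => ∃ y ∈ C b, near (comb ω a) y) ε (ε / 2 ^ l) hε (by positivity)
    (by
      simp only [Fintype.card_pi, ZMod.card, Finset.prod_const, Finset.card_univ,
        Fintype.card_fin, Nat.cast_pow, Nat.cast_ofNat]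
      rw [mul_div_cancel₀ _ (by positivity)]) hE heavy (fun ω a ha => by
      refine le_of_eq_of_le ?_ (not_le.1 ha).le
      congr)
  choose ρ hρ1 hρ2 hρ3 using fun ω => exists_decomposition hJT' hunion (hφ ω) (hψ ω) Y
    (Finset.univ.filter (heavy ω)) (m := (l₁ + l) + (l₁ + l)) (fun a ha => by
      rcases hY3 (comb ω a) (hcomb ω a) (Finset.mem_filter.1 ha).2 with hmem | hclose
      · refine ⟨_, hmem, ?_⟩
        rw [show ∑ j, a j • ψ ω j + comb ω a = 0 from hself _]
        exact .zero _
      · exact hclose)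
  obtain ⟨𝒮, h𝒮1, h𝒮2, h𝒮3⟩ := H₂ V Ω w l ρ _ hB.nonneg hB.sum_le_one hρ1 (by
    refine le_trans ?_ hS'
    linarith) (fun b hb => by
      have hεε : 10 * ε ≤ ε₂ := by
        have := min_le_right ε₁ (ε₂ / 10)
        rw [← hεdef] at this
        linarith
      refine (mass_mono hB.nonneg fun ω hω hh => ?_).trans
        ((Finset.mem_filter.1 hb).2.trans hεε)
      obtain ⟨j, hj⟩ := hω
      exact hj (hρ2 ω b (Finset.mem_filter.2 ⟨Finset.mem_univ _, hh⟩) j))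
  refine H₁ V Ω w r B ε (𝒮 ∪ Y.image fun y => (T \ J, y)) (min_le_left _ _) hB ?_ ?_ ?_
  · exact (Finset.card_union_le _ _).trans (Nat.add_le_add h𝒮1 (Finset.card_image_le.trans hY1))
  · refine (h𝒮2.mono hJT').union fun s hs => ?_
    obtain ⟨y, hy, rfl⟩ := Finset.mem_image.1 hs
    exact ⟨⟨t, htTJ⟩, Finset.sdiff_subset, hY2 y hy⟩
  · refine (mass_mono hB.nonneg fun ω hω => ?_).trans h𝒮3
    by_contra! hall
    obtain ⟨g', hg', hmem⟩ := hρ3 ω 𝒮 h𝒮2 hall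
    refine hω ⟨g' + g ω, hg'.add_lowRank (hg ω), ?_⟩
    rw [hrφ ω, add_add_add_comm, hself, add_zero]
    convert hmem

/-- Forms of bounded partition rank are captured, by eliminating the types of products in the
order of increasing size. -/
theorem CapturesLow.of_upward_closed {T : Finset ι} {t : ι} (ht : t ∈ T)
    (hT : ∀ U, U ⊂ T → Captures U) (n : ℕ) : ∀ 𝒥 : Finset (Finset ι), 𝒥.card = n →
    𝒥 ⊆ properParts T t → (∀ J ∈ 𝒥, ∀ K ∈ properParts T t, J ⊆ K → K ∈ 𝒥) →
    CapturesLow 𝒥 T := by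
  induction n with
  | zero =>
    intro 𝒥 h𝒥 _ _
    rw [Finset.card_eq_zero.1 h𝒥]
    exact capturesLow_empty T
  | succ n ih =>
    intro 𝒥 hcard h𝒥 hup
    obtain ⟨J, hJ⟩ := 𝒥.exists_minimal (Finset.card_pos.1 (by omega))
    have hmin : ∀ K ∈ 𝒥, K ⊆ J → K = J := fun K hK hKJ =>
      Finset.Subset.antisymm hKJ (hJ.2 hK hKJ)
    refine CapturesLow.of_erase ht hT h𝒥 hup hJ.1 hmin (ih _ ?_ ?_ ?_)
    · rw [Finset.card_erase_of_mem hJ.1, hcard]; rfl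
    · exact (Finset.erase_subset _ _).trans h𝒥
    · intro L hL K hK hLK
      obtain ⟨hne, hL⟩ := Finset.mem_erase.1 hL
      refine Finset.mem_erase.2 ⟨fun he => hne (hmin L hL (he ▸ hLK)), hup L hL K hK hLK⟩

/-- Every weighted family of forms that almost vanishes on a dense set is captured by a structured
space. -/
theorem captures (T : Finset ι) : Captures T := by
  classical
  induction T using Finset.strongInduction with
  | H T ih =>
  rcases T.eq_empty_or_nonempty with rfl | ⟨t, ht⟩
  · exact captures_empty
  have hlow := CapturesLow.of_upward_closed ht ih _ (properParts T t) rfl subset_rfl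
    fun _ _ K hK _ => hK
  have h𝒥 : ∀ J ∈ properParts T t, J ⊆ T := fun J hJ =>
    (mem_properParts.1 hJ).2.trans (Finset.erase_subset _ _)
  intro η hη
  obtain ⟨ε₁, hε₁, H₁⟩ := hlow.modulo h𝒥 η hη
  refine ⟨min ε₁ (η / 8), by positivity, fun δ hδ => ?_⟩
  obtain ⟨N, l, hcover⟩ := (ih _ (Finset.erase_ssubset ht)).exists_cover ht δ hδ
  obtain ⟨k, H₁⟩ := H₁ δ hδ N l
  refine ⟨k, ?_⟩
  intro V _ _ _ Ω _ w r B hB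
  obtain ⟨Y, hY1, hY2, hY3⟩ := hcover V B hB.dense
  refine H₁ V Ω w r B _ (Y.image fun y => (T, y)) (min_le_left _ _) hB
    (Finset.card_image_le.trans hY1) (fun s hs => ?_) ?_
  · obtain ⟨y, hy, rfl⟩ := Finset.mem_image.1 hs
    exact ⟨⟨t, ht⟩, subset_rfl, hY2 y hy⟩
  have hne : B.Nonempty := by
    have hX : (0 : ℝ) < Fintype.card (∀ i, V i) := by exact_mod_cast Fintype.card_pos
    have : (0 : ℝ) < B.card := lt_of_lt_of_le (by positivity) hB.dense
    rw [← Finset.card_pos]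
    exact_mod_cast this
  refine (mass_mono hB.nonneg fun ω hω hspec => hω ?_).trans
    ((mass_contract_le hB.nonneg hne hB.vanish).trans ?_)
  · have := min_le_right ε₁ (η / 8)
    linarith
  · obtain ⟨y, hy, h⟩ := hY3 (r ω) (hB.mem ω) hspec
    refine ⟨_, h, ?_⟩
    have hself : r ω + r ω = 0 := funext fun x => zmod_two_add_self _
    rw [← add_assoc, hself, zero_add, ← mul_one y]
    exact mul_mem_tspan (s := (T, y)) (Finset.mem_image_of_mem _ hy) (by simp [MLin])

end Induction

/-! ### Fourier analysis on a finite vector space over `𝔽₂` -/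

section Fourier

variable {G : Type} [AddCommGroup G] [Module (ZMod 2) G] [Fintype G]

instance fintype_dual : Fintype (Module.Dual (ZMod 2) G) := by
  classical
  exact Fintype.ofInjective (fun χ : Module.Dual (ZMod 2) G => (χ : G → ZMod 2))
    DFunLike.coe_injective

omit [Fintype G] in
theorem module_add_self (g : G) : g + g = 0 := by
  rw [← two_smul (ZMod 2) g, show (2 : ZMod 2) = 0 from rfl, zero_smul]

open Classical in
theorem sum_sgn_dualAnnihilator (W : Submodule (ZMod 2) G) (g : G) :
    ∑ χ : Module.Dual (ZMod 2) G with χ ∈ W.dualAnnihilator, sgn (χ g) =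
      if g ∈ W then (Nat.card W.dualAnnihilator : ℝ) else 0 := by
  split_ifs with hg
  · rw [Finset.sum_congr (g := fun _ => (1 : ℝ)) rfl fun χ hχ => by
      rw [(Submodule.mem_dualAnnihilator χ).1 (Finset.mem_filter.1 hχ).2 g hg, sgn_zero]]
    simp [Nat.card_eq_fintype_card, Fintype.card_subtype]
  · obtain ⟨χ₀, h₀, hne⟩ : ∃ χ₀ ∈ W.dualAnnihilator, χ₀ g ≠ 0 := by
      by_contra! hcon
      exact hg ((Subspace.forall_mem_dualAnnihilator_apply_eq_zero_iff W g).1 hcon)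
    have h1 : χ₀ g = 1 := (eq_zero_or_one _).resolve_left hne
    have h2 : ∑ χ : Module.Dual (ZMod 2) G with χ ∈ W.dualAnnihilator, sgn (χ g) =
        ∑ χ : Module.Dual (ZMod 2) G with χ ∈ W.dualAnnihilator, sgn ((χ + χ₀) g) := by
      simp only [Finset.sum_filter]
      rw [← Equiv.sum_comp (Equiv.addRight χ₀)]
      refine Finset.sum_congr rfl fun χ _ => ?_
      simp only [Equiv.coe_addRight, Submodule.add_mem_iff_left _ h₀]
    simp only [LinearMap.add_apply, h1, sgn_add, sgn_one, ← Finset.sum_mul] at h2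
    linarith

theorem card_mul_card_dualAnnihilator (W : Submodule (ZMod 2) G) :
    Nat.card W * Nat.card W.dualAnnihilator = Fintype.card G := by
  rw [Module.natCard_eq_pow_finrank (K := ZMod 2) (V := W),
    Module.natCard_eq_pow_finrank (K := ZMod 2) (V := W.dualAnnihilator), ← pow_add,
    Subspace.finrank_add_finrank_dualAnnihilator_eq, ← Module.natCard_eq_pow_finrank,
    Nat.card_eq_fintype_card]

open Classical in
/-- Parseval's identity, for the restriction of the Fourier transform of the indicator function of
`A` to the annihilator of a subspace. -/
theorem sum_sq_fourier (A : Finset G) (W : Submodule (ZMod 2) G) (b : G) :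
    ∑ χ : Module.Dual (ZMod 2) G with χ ∈ W.dualAnnihilator,
      (∑ a ∈ A, sgn (χ a)) ^ 2 * sgn (χ b) =
      Nat.card W.dualAnnihilator * ∑ a ∈ A, ((A.filter fun a' => a + a' + b ∈ W).card : ℝ) := by
  have h1 : ∀ χ : Module.Dual (ZMod 2) G, (∑ a ∈ A, sgn (χ a)) ^ 2 * sgn (χ b) =
      ∑ a ∈ A, ∑ a' ∈ A, sgn (χ (a + a' + b)) := fun χ => by
    rw [sq, Finset.sum_mul_sum]
    simp only [map_add, sgn_add, Finset.sum_mul]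
  simp only [h1]
  rw [Finset.sum_comm, Finset.mul_sum]
  refine Finset.sum_congr rfl fun a _ => ?_
  rw [Finset.sum_comm]
  simp only [sum_sgn_dualAnnihilator, ← Finset.sum_filter, Finset.sum_const, nsmul_eq_mul]
  ring

/-- The normalised weights `|Â(χ)|²` of the characters. -/
def fourierWeight (A : Finset G) (χ : Module.Dual (ZMod 2) G) : ℝ :=
  (∑ a ∈ A, sgn (χ a)) ^ 2 / (Fintype.card G * A.card)

theorem fourierWeight_nonneg (A : Finset G) (χ : Module.Dual (ZMod 2) G) :
    0 ≤ fourierWeight A χ := by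
  unfold fourierWeight
  positivity

open Classical in
theorem sum_fourierWeight_mul (A : Finset G) (hA : A.Nonempty) (b : G) :
    ∑ χ, fourierWeight A χ * sgn (χ b) = (A.filter fun a => a + b ∈ A).card / A.card := by
  have hG : (0 : ℝ) < Fintype.card G := by exact_mod_cast Fintype.card_pos
  have hA' : (0 : ℝ) < A.card := by exact_mod_cast hA.card_pos
  have h1 := sum_sq_fourier A ⊥ b
  have h2 := card_mul_card_dualAnnihilator (⊥ : Submodule (ZMod 2) G)
  rw [Nat.card_unique, one_mul] at h2
  rw [h2] at h1
  simp only [Submodule.dualAnnihilator_bot, Submodule.mem_top, Finset.filter_true,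
    Submodule.mem_bot] at h1
  have h3 : ∑ a ∈ A, ((A.filter fun a' => a + a' + b = 0).card : ℝ) =
      (A.filter fun a => a + b ∈ A).card := by
    rw [Finset.card_filter]
    push_cast
    refine Finset.sum_congr rfl fun a _ => ?_
    have hiff : ∀ a', a + a' + b = 0 ↔ a' = a + b := fun a' => by
      constructor
      · intro h
        have h' : a' + (a + b) = 0 := by rw [← h]; abel
        have := congrArg (· + (a + b)) h'
        simpa [add_assoc a', module_add_self] using this
      · rintro rfl
        rw [show a + (a + b) + b = (a + a) + (b + b) by abel, module_add_self, module_add_self,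
          add_zero]
    by_cases h : a + b ∈ A
    · have : (A.filter fun a' => a + a' + b = 0) = {a + b} := by
        ext a'
        simp only [Finset.mem_filter, hiff, Finset.mem_singleton]
        exact ⟨fun h' => h'.2, fun h' => ⟨h' ▸ h, h'⟩⟩
      rw [this, if_pos h, Finset.card_singleton, Nat.cast_one]
    · have : (A.filter fun a' => a + a' + b = 0) = ∅ := by
        refine Finset.filter_false_of_mem fun a' ha' h' => h ?_
        rwa [← (hiff a').1 h']
      rw [this, if_neg h, Finset.card_empty, Nat.cast_zero]
  rw [h3] at h1
  simp only [fourierWeight, div_mul_eq_mul_div]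
  rw [← Finset.sum_div, h1]
  field_simp

theorem sum_fourierWeight (A : Finset G) (hA : A.Nonempty) : ∑ χ, fourierWeight A χ = 1 := by
  classical
  have := sum_fourierWeight_mul A hA 0
  have hA' : (A.card : ℝ) ≠ 0 := by exact_mod_cast hA.card_pos.ne'
  simpa [sgn_zero, hA'] using this

open Classical in
/-- If `b` almost stabilises `A`, then most of the Fourier mass of `A` is on characters that are
trivial at `b`. -/
theorem mass_fourierWeight (A : Finset G) (hA : A.Nonempty) (b : G) :
    2 * mass (fourierWeight A) (fun χ => χ b ≠ 0) =
      1 - (A.filter fun a => a + b ∈ A).card / A.card := by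
  rw [← sum_fourierWeight_mul A hA b, ← sum_fourierWeight A hA, mass_eq_sum_ite, Finset.mul_sum,
    ← Finset.sum_sub_distrib]
  refine Finset.sum_congr rfl fun χ _ => ?_
  by_cases h : χ b = 0
  · simp [h, sgn_zero]
  · rw [if_pos h, sgn, if_neg h]
    ring

/-- If half of the Fourier mass of `A` is on the annihilator of `W`, then `A` is dense in a coset
of `W`. -/
theorem exists_dense_coset (A : Finset G) (hA : A.Nonempty) (W : Submodule (ZMod 2) G)
    (h : 1 / 2 ≤ mass (fourierWeight A) (fun χ => χ ∈ W.dualAnnihilator)) :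
    ∃ x : G, (1 / 2 : ℝ) * (((fun y => x + y) '' (W : Set G)).ncard : ℝ) ≤
      ((((fun y => x + y) '' (W : Set G)) ∩ A).ncard : ℝ) := by
  classical
  have hG : (0 : ℝ) < Fintype.card G := by exact_mod_cast Fintype.card_pos
  have hA' : (0 : ℝ) < A.card := by exact_mod_cast hA.card_pos
  have h1 := sum_sq_fourier A W 0
  simp only [map_zero, sgn_zero, mul_one, add_zero] at h1
  have h2 : (Nat.card W * Nat.card W.dualAnnihilator : ℝ) = Fintype.card G := by
    exact_mod_cast card_mul_card_dualAnnihilator W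
  have hW : (0 : ℝ) < Nat.card W.dualAnnihilator := by exact_mod_cast Nat.card_pos
  have h3 : mass (fourierWeight A) (fun χ => χ ∈ W.dualAnnihilator) =
      (Nat.card W.dualAnnihilator * ∑ a ∈ A, ((A.filter fun a' => a + a' ∈ W).card : ℝ)) /
        (Fintype.card G * A.card) := by
    rw [← h1, mass, Finset.sum_div]
    exact Finset.sum_congr (by congr) fun _ _ => rfl
  rw [h3, le_div_iff₀ (by positivity), ← h2] at h
  have h4 : A.card * ((1 : ℝ) / 2 * Nat.card W) ≤
      ∑ a ∈ A, ((A.filter fun a' => a + a' ∈ W).card : ℝ) := by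
    refine le_of_mul_le_mul_left ?_ hW
    linarith
  rw [← nsmul_eq_mul, ← Finset.sum_const] at h4
  obtain ⟨x, _, hx⟩ := Finset.exists_le_of_sum_le hA h4
  refine ⟨x, ?_⟩
  have h5 : ((fun y => x + y) '' (W : Set G)).ncard = Nat.card W := by
    rw [Set.ncard_image_of_injective _ (add_right_injective x)]
    rfl
  have h6 : (((fun y => x + y) '' (W : Set G)) ∩ A) =
      ((A.filter fun a' => x + a' ∈ W : Finset G) : Set G) := by
    ext a
    simp only [Set.mem_inter_iff, Set.mem_image, SetLike.mem_coe, Finset.coe_filter,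
      Set.mem_ofPred_eq]
    constructor
    · rintro ⟨⟨y, hy, rfl⟩, ha⟩
      exact ⟨ha, by rwa [← add_assoc, module_add_self, zero_add]⟩
    · rintro ⟨ha, hxa⟩
      exact ⟨⟨x + a, hxa, by rw [← add_assoc, module_add_self, zero_add]⟩, ha⟩
  rw [h5, h6, Set.ncard_coe_finset]
  exact hx

end Fourier

/-! ### Forms and linear functionals on tensor products -/

section Tensor

variable {d : ℕ} (n : Fin d → ℕ)

theorem dual_comp_tprod_mem_MLin (χ : Module.Dual (ZMod 2) (Tens n)) :
    (fun x => χ (PiTensorProduct.tprod (ZMod 2) x)) ∈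
      MLin (fun i => F2 (n i)) (Finset.univ : Finset (Fin d)) := by
  refine ⟨fun i _ x a b => ?_, fun i hi => absurd (Finset.mem_univ i) hi⟩
  simp only [MultilinearMap.map_update_add, map_add]

/-- A form in the coordinates with the property `p` is a linear functional on the tensor product
of these coordinates. -/
theorem exists_functional (p : Fin d → Prop) [DecidablePred p]
    (f : (∀ i, F2 (n i)) → ZMod 2) (hf : f ∈ MLin (fun i => F2 (n i)) (Finset.univ.filter p)) :
    ∃ F : (⨂[ZMod 2] i : {i : Fin d // p i}, F2 (n i)) →ₗ[ZMod 2] ZMod 2,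
      ∀ x : (∀ i, F2 (n i)),
        F (PiTensorProduct.tprod (ZMod 2) fun i : {i : Fin d // p i} => x i) = f x := by
  let ext : (∀ i : {i : Fin d // p i}, F2 (n i)) → ∀ i, F2 (n i) := fun y i =>
    if h : p i then y ⟨i, h⟩ else 0
  have hext : ∀ [DecidableEq {i : Fin d // p i}] (y : ∀ i : {i : Fin d // p i}, F2 (n i))
      (i : {i : Fin d // p i}) (a : F2 (n i)),
      ext (Function.update y i a) = Function.update (ext y) i.1 a := by
    intro _ y i a
    funext j
    by_cases hji : j = i.1
    · subst hji
      simp [ext, i.2]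
    · rw [Function.update_of_ne hji]
      by_cases hj : p j
      · simp only [ext, hj, dif_pos]
        rw [Function.update_of_ne fun h => hji (congrArg Subtype.val h)]
      · simp [ext, hj]
  have hmem : ∀ i : {i : Fin d // p i}, i.1 ∈ Finset.univ.filter p := fun i => by simp [i.2]
  let M : MultilinearMap (ZMod 2) (fun i : {i : Fin d // p i} => F2 (n i)) (ZMod 2) :=
    { toFun := fun y => f (ext y)
      map_update_add' := fun y i a b => by
        rw [hext, hext, hext]
        exact MLin.update_add hf (hmem i) _ _ _
      map_update_smul' := fun y i c a => by
        rw [hext, hext]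
        exact MLin.update_smul hf (hmem i) _ _ _ }
  refine ⟨PiTensorProduct.lift M, fun x => ?_⟩
  rw [PiTensorProduct.lift.tprod]
  have h1 := MLin.piecewise_of_subset hf (Finset.univ.filter p) subset_rfl x fun _ => 0
  rw [← h1]
  refine congrArg f (funext fun i => ?_)
  by_cases hi : p i <;> simp [ext, hi]

/-- The cylinders over the kernels of finitely many forms, in all sets of coordinates, are
annihilated by the functionals that belong to the structured space of these forms. -/
theorem exists_subspaces (𝒮 : Finset (Finset (Fin d) × ((∀ i, F2 (n i)) → ZMod 2)))
    (h𝒮 : Admissible Finset.univ 𝒮) :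
    ∃ H : (I : Finset (Fin d)) → Submodule (ZMod 2) (TensOn n I),
      (∀ I, Module.finrank (ZMod 2) (TensOn n I ⧸ H I) ≤ 𝒮.card) ∧
      ∀ χ : Module.Dual (ZMod 2) (Tens n),
        (fun x => χ (PiTensorProduct.tprod (ZMod 2) x)) ∈ tspan Finset.univ 𝒮 →
        ∀ y : Tens n, (∀ I : Finset (Fin d), I.Nonempty → y ∈ cylinder n I (H I)) → χ y = 0 := by
  have hL : ∀ (I : Finset (Fin d)) (f : (∀ i, F2 (n i)) → ZMod 2),
      ∃ F : TensOn n I →ₗ[ZMod 2] ZMod 2, f ∈ MLin (fun i => F2 (n i)) I →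
        ∀ x : (∀ i, F2 (n i)),
          F (PiTensorProduct.tprod (ZMod 2) fun i : {i : Fin d // i ∈ I} => x i) = f x := by
    intro I f
    by_cases hf : f ∈ MLin (fun i => F2 (n i)) I
    · obtain ⟨F, hF⟩ := exists_functional n (fun i => i ∈ I) f (by
        rwa [Finset.filter_univ_mem])
      exact ⟨F, fun _ => hF⟩
    · exact ⟨0, fun h => absurd h hf⟩
  choose L hL using hL
  let Λ : (I : Finset (Fin d)) → TensOn n I →ₗ[ZMod 2] (𝒮 → ZMod 2) := fun I =>
    LinearMap.pi fun s => L I s.1.2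
  refine ⟨fun I => LinearMap.ker (Λ I), fun I => ?_, ?_⟩
  · rw [(Λ I).quotKerEquivRange.finrank_eq]
    refine (Submodule.finrank_le _).trans ?_
    simp
  -- each form of the structured space comes from a functional that vanishes on the cylinders
  have key : ∀ f ∈ tspan (V := fun i => F2 (n i)) Finset.univ 𝒮,
      ∃ χ : Module.Dual (ZMod 2) (Tens n),
      (∀ x, χ (PiTensorProduct.tprod (ZMod 2) x) = f x) ∧
      ∀ y : Tens n, (∀ I : Finset (Fin d), I.Nonempty →
        y ∈ cylinder n I (LinearMap.ker (Λ I))) → χ y = 0 := by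
    intro f hf
    induction hf using Submodule.span_induction with
    | mem f hf =>
      obtain ⟨⟨I, σ⟩, hs, ψ, hψ, rfl⟩ := hf
      obtain ⟨hI, -, hσ⟩ := h𝒮 _ hs
      obtain ⟨F, hF⟩ := exists_functional n (fun i => i ∉ I) ψ (by
        convert hψ using 2
        ext i
        simp)
      refine ⟨LinearMap.mul' (ZMod 2) (ZMod 2) ∘ₗ TensorProduct.map (L I σ) F ∘ₗ
        (glue n I).symm.toLinearMap, fun x => ?_, fun y hy => ?_⟩
      · have h1 : (glue n I).symm (PiTensorProduct.tprod (ZMod 2) x) =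
            (PiTensorProduct.tprod (ZMod 2) fun i : {i : Fin d // i ∈ I} => x i) ⊗ₜ[ZMod 2]
            (PiTensorProduct.tprod (ZMod 2) fun i : {i : Fin d // i ∉ I} => x i) := by
          rw [LinearEquiv.symm_apply_eq, glue_tprod]
        simp only [LinearMap.comp_apply, LinearEquiv.coe_coe, h1, TensorProduct.map_tmul,
          LinearMap.mul'_apply, hL I σ hσ, hF, Pi.mul_apply]
      · obtain ⟨z, ⟨z', rfl⟩, rfl⟩ := hy I hI
        have h0 : L I σ ∘ₗ (LinearMap.ker (Λ I)).subtype = 0 := by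
          ext1 u
          exact congrFun (LinearMap.mem_ker.1 u.2) ⟨(I, σ), hs⟩
        have h2 : TensorProduct.map (L I σ) F ∘ₗ
            (LinearMap.ker (Λ I)).subtype.rTensor (TensOff n I) = 0 := by
          rw [LinearMap.rTensor, ← TensorProduct.map_comp, h0, TensorProduct.map_zero_left]
        have h3 := LinearMap.congr_fun h2 z'
        simp only [LinearMap.comp_apply, LinearMap.zero_apply] at h3
        simp [h3]
    | zero => exact ⟨0, fun _ => rfl, fun _ _ => rfl⟩
    | add f g _ _ hf hg =>
      obtain ⟨χ, h1, h2⟩ := hf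
      obtain ⟨χ', h1', h2'⟩ := hg
      exact ⟨χ + χ', fun x => by simp [h1, h1'], fun y hy => by simp [h2 y hy, h2' y hy]⟩
    | smul c f _ hf =>
      obtain ⟨χ, h1, h2⟩ := hf
      exact ⟨c • χ, fun x => by simp [h1], fun y hy => by simp [h2 y hy]⟩
  intro χ hχ y hy
  obtain ⟨χ', h1, h2⟩ := key _ hχ
  have : χ = χ' := PiTensorProduct.ext (MultilinearMap.ext fun x => (h1 x).symm)
  rw [this]
  exact h2 y hy

theorem exists_le_of_le_map {α β : Type} (f : α → β) (s : Multiset α) :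
    ∀ t : Multiset β, t ≤ s.map f → ∃ u ≤ s, u.map f = t := by
  classical
  induction s using Multiset.induction_on with
  | empty => exact fun t ht => ⟨0, le_rfl, (Multiset.le_zero.1 ht).symm⟩
  | cons a s ih =>
    intro t ht
    rw [Multiset.map_cons] at ht
    by_cases ha : f a ∈ t
    · obtain ⟨u, hu, he⟩ := ih (t.erase (f a)) (Multiset.erase_le_iff_le_cons.2 ht)
      exact ⟨a ::ₘ u, Multiset.cons_le_cons a hu, by
        rw [Multiset.map_cons, he, Multiset.cons_erase ha]⟩
    · obtain ⟨u, hu, he⟩ := ih t ((Multiset.le_cons_of_notMem ha).1 ht)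
      exact ⟨u, hu.trans (Multiset.le_cons_self _ _), he⟩

open Classical in
/-- If `N b ≤ m` averages at least `(1 - ε) m` over `B`, then `N b ≥ (1 - 2 ε) m` for half of the
elements of `B`. -/
theorem card_le_two_mul_card_large {X : Type} (B : Finset X) (N : X → ℝ) (m ε : ℝ) (hε : 0 < ε)
    (hm : 0 < m) (hN : ∀ b ∈ B, N b ≤ m) (h : (1 - ε) * m * B.card ≤ ∑ b ∈ B, N b) :
    (B.card : ℝ) ≤ 2 * (B.filter fun b => (1 - 2 * ε) * m ≤ N b).card := by
  have h1 : ∑ b ∈ B, N b ≤ ∑ b ∈ B,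
      ((1 - 2 * ε) * m + if (1 - 2 * ε) * m ≤ N b then 2 * ε * m else 0) := by
    refine Finset.sum_le_sum fun b hb => ?_
    have := hN b hb
    split_ifs with h <;> linarith
  rw [Finset.sum_add_distrib, ← Finset.sum_filter, Finset.sum_const, Finset.sum_const,
    nsmul_eq_mul, nsmul_eq_mul] at h1
  have h2 : ε * m * B.card ≤
      ε * m * (2 * (B.filter fun b => (1 - 2 * ε) * m ≤ N b).card) := by linarith
  exact le_of_mul_le_mul_left h2 (by positivity)

end Tensor

end RankOneClosed

end

theorem corollary2p6 (d : ℕ) (hd : 0 < d) :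
    ∃ ε : ℝ, 0 < ε ∧ ∀ δ : ℝ, 0 < δ → ∃ k : ℕ, 0 < k ∧
      ∀ (n : Fin d → ℕ) (B' : Multiset (RankOneClosed.Tens n)),
        B' ≤ RankOneClosed.rankOne n →
        δ * (Multiset.card (RankOneClosed.rankOne n) : ℝ) ≤ (Multiset.card B' : ℝ) →
        ∀ A : Set (RankOneClosed.Tens n), A.Nonempty →
          RankOneClosed.IsClosedFor B' (1 - ε) A →
          ∃ D : Set (RankOneClosed.Tens n), RankOneClosed.IsSimple n k D ∧
            (1 / 2 : ℝ) * (D.ncard : ℝ) ≤ ((D ∩ A).ncard : ℝ) := by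
  classical
  open RankOneClosed in
  obtain ⟨ε, hε, H⟩ := captures (Finset.univ : Finset (Fin d)) (1 / 2) (by norm_num)
  refine ⟨ε, hε, fun δ hδ => ?_⟩
  obtain ⟨k, H⟩ := H (δ / 2) (by positivity)
  refine ⟨k + 1, k.succ_pos, ?_⟩
  intro n B' hB' hcard A hA hclosed
  have : Fintype (Tens n) := Fintype.ofFinite _
  obtain ⟨u, hu, rfl⟩ := exists_le_of_le_map _ _ _ hB'
  let B : Finset (∀ i, F2 (n i)) := ⟨u, Multiset.nodup_of_le hu Finset.univ.nodup⟩
  have hBu : B.val = u := rfl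
  obtain ⟨A, rfl⟩ := A.toFinite.exists_finset_coe
  rw [Finset.coe_nonempty] at hA
  have hA' : (0 : ℝ) < A.card := by exact_mod_cast hA.card_pos
  simp only [rankOne, Multiset.card_map, Finset.card_val, Finset.card_univ, ← hBu] at hcard
  have hN : ∀ b : Tens n, {a : Tens n | a ∈ (A : Set (Tens n)) ∧ a + b ∈ (A : Set (Tens n))}.ncard =
      (A.filter fun a => a + b ∈ A).card := fun b => by
    rw [← Set.ncard_coe_finset]
    congr 1
    ext a
    simp
  rw [IsClosedFor, Set.ncard_coe_finset, ← hBu, Multiset.map_map, Multiset.card_map,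
    Finset.card_val] at hclosed
  simp only [Function.comp_def, hN] at hclosed
  -- most translates by the elements of `B` almost stabilise `A`
  have hlarge := card_le_two_mul_card_large B
    (fun b => ((A.filter fun a => a + PiTensorProduct.tprod (ZMod 2) b ∈ A).card : ℝ)) A.card ε hε
    hA' (fun b _ => by exact_mod_cast Finset.card_filter_le _ _) (by
      refine hclosed.trans (le_of_eq ?_)
      push_cast
      rw [Multiset.map_map]
      rfl)
  obtain ⟨𝒮, h1, h2, h3⟩ := H (fun i => F2 (n i)) (Module.Dual (ZMod 2) (Tens n))
    (fourierWeight A) (fun χ x => χ (PiTensorProduct.tprod (ZMod 2) x)) _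
    { nonneg := fourierWeight_nonneg A
      sum_le_one := (sum_fourierWeight A hA).le
      mem := dual_comp_tprod_mem_MLin n
      dense := by
        refine le_trans ?_ ((div_le_iff₀' two_pos).2 hlarge)
        linarith
      vanish := fun b hb => by
        have h4 := mass_fourierWeight A hA (PiTensorProduct.tprod (ZMod 2) b)
        have h5 := (le_div_iff₀ hA').2 (Finset.mem_filter.1 hb).2
        linarith }
  obtain ⟨S, hS1, hS2⟩ := exists_subspaces n 𝒮 h2
  let W : Submodule (ZMod 2) (Tens n) :=
    ⨅ (I : Finset (Fin d)) (_ : I.Nonempty), cylinder n I (S I)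
  have hW : (W : Set (Tens n)) =
      {y : Tens n | ∀ I : Finset (Fin d), I.Nonempty → y ∈ cylinder n I (S I)} := by
    ext y
    simp [W]
  have h6 := mass_add_mass_not (w := fourierWeight A) (P := fun χ : Module.Dual (ZMod 2) (Tens n) =>
    (fun x => χ (PiTensorProduct.tprod (ZMod 2) x)) ∉ tspan Finset.univ 𝒮)
  rw [sum_fourierWeight A hA] at h6
  obtain ⟨x, hx⟩ := exists_dense_coset A hA W (by
    refine le_trans ?_ (mass_mono (fourierWeight_nonneg A) (P := fun χ => ¬
      (fun x => χ (PiTensorProduct.tprod (ZMod 2) x)) ∉ tspan Finset.univ 𝒮) fun χ hχ => ?_)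
    · linarith
    · refine (Submodule.mem_dualAnnihilator χ).2 fun y hy => ?_
      rw [← SetLike.mem_coe, hW] at hy
      exact hS2 χ (not_not.1 hχ) y hy)
  refine ⟨_, ⟨S, x, fun I _ => (hS1 I).trans (h1.trans k.le_succ), ?_⟩, hx⟩
  rw [hW]
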